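/- **Language.** Let $\mathit{Var}=\{x,x_1,x_2,\dots\}$ and consider the terms \[ \begin{aligned} \mathit{Stmt} &::= \mathit{Var}:=\mathit{Exp}\mid \mathit{Stmt};\mathit{Stmt}\mid \mathsf{if}\ \mathit{BExp}\ \mathsf{then}\ \mathit{Stmt}\ \mathsf{else}\ \mathit{Stmt}\mid \mathsf{while}\ \mathit{BExp}\ \mathsf{do}\ \mathit{Stmt},\\ \mathit{Exp} &::= \mathit{Var}\mid 1\mid 0\mid \mathit{Exp}+\mathit{Exp}\mid \mathit{Exp}-\mathit{Exp},\\ \mathit{BExp} &::= \mathsf t\mid \mathsf f\mid \neg \mathit{BExp}\mid \mathit{BExp}\wedge \mathit{BExp}\mid \mathit{Exp}<\mathit{Exp}\mid \mathit{Exp}==\mathit{Exp}. \end{aligned} \] A *state* is a triple $\sigma=(h,e_t,b_t)$ with $h:\mathit{Var}\to\mathbb Z$, $e_t\in\mathbb Z$, $b_t\in\{\mathsf t,\mathsf f\}$. An integer (Boolean) expression acts on states by storing its value in $e_t$ (in $b_t$); statements act in the usual way on $h$ (big-step semantics, with the least fixed point for $\mathsf{while}$). For a program $c$ (a term of type $\mathit{Stmt}$,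 $\mathit{Exp}$ or $\mathit{BExp}$) let $[c](\sigma)$ be the resulting state, or $\uparrow$ if $c$ does not terminate on $\sigma$; put $[c](\uparrow)=\uparrow$. Let $\mathit{vars}(c)$ be the set of variables in $c$, and $\mathit{vars}(C)=\bigcup_{c\in C}\mathit{vars}(c)$. **Vector-states.** $\mathit{EVS}$ is the set of all finite sequences of states, all finite sequences of states followed by one final entry $\uparrow$, and all infinite sequences $\sigma_1,\sigma_2,\dots$ of states $\sigma_i=(h_i,\cdot,\cdot)$ for which $(i,y)\mapsto h_i(y)$ is computable. A sequence $[v_1,\dots,v_k,\uparrow]$ *occludes* every sequence in $\mathit{EVS}$ that begins with $v_1,\dots,v_k$ and is infinite or ends in $\uparrow$. For $V\subseteq\mathit{EVS}$, $\mathit{reduce}(V)$ is obtained from $V$ by replacing each sequence that is infinite or ends in $\uparrow$ and is occluded by an element of $V$ by its shortest occluder in $V$. **Divergence-aware vector-state semantics.** For a program $c$ and $v\in\mathit{EVS}$ let $c(v)$ be the sequence that arises from $v$ by applying $[c]$ to each entry and cutting off after the first $\uparrow$, if there is one. For a set $C$ of programs of one type and $V\subseteq\mathit{EVS}$ let \[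 \llbracket C\rrbracket(V)=\mathit{reduce}\Bigl(\,\bigcup_{c\in C}\mathit{reduce}\bigl(\{c(v)\mid v\in V\}\bigr)\Bigr). \] The denotation of $C$ is the map $\llbracket C\rrbracket:2^{\mathit{EVS}}\to2^{\mathit{EVS}}$ together with the set $\mathit{vars}(C)$. The denotation of a set of variables (terms of type $\mathit{Var}$) is the set itself. **Theorem.** The divergence-aware vector-state semantics admits a compositional characterization: there are a function $f_\alpha$ for each constructor $\alpha$ of the language (including $\mathsf{while}$, and each variable as a nullary constructor of type $\mathit{Var}$) and an aggregation function $f_\cup$ (for each type, on finite tuples of denotations of that type), such that for every typed regular tree grammar over these constructors (with finitely many nonterminals and productions) and every nonterminal $N$, with productions \[ N::=\alpha_1(N_{1,1},\dots,N_{1,n_1})\mid\dots\mid\alpha_k(N_{k,1},\dots,N_{k,n_k}), \] the denotation $D(L(N))$ of the set $L(N)$ of the terms derivable from $N$ satisfies \[ D(L(N))=f_\cup\bigl(f_{\alpha_1}(D(L(N_{1,1})),\dots,D(L(N_{1,n_1}))),\ \dots,\ f_{\alpha_k}(D(L(N_{k,1})),\dots,D(L(N_{k,n_k})))\bigr). \]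 -/

import Mathlib

/-! A deterministic imperative language, sets of programs given by regular tree grammars, and the
divergence-aware vector-state semantics of such sets. -/

namespace GImp

/-- The variables `x, x_1, x_2, …` of the language; the number is the index (`x` is `0`). -/
abbrev Var : Type := ℕ

/-- Integer expressions. -/
inductive Exp : Type
  | var (x : Var)
  | zero
  | one
  | add (e₁ e₂ : Exp)
  | sub (e₁ e₂ : Exp)

/-- Boolean expressions. -/
inductive BExp : Type
  | tt
  | ff
  | neg (b : BExp)
  | conj (b₁ b₂ : BExp)
  | lt (e₁ e₂ : Exp)
  | eq (e₁ e₂ : Exp)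

/-- Statements. -/
inductive Stmt : Type
  | assign (x : Var) (e : Exp)
  | seq (s₁ s₂ : Stmt)
  | ite (b : BExp) (s₁ s₂ : Stmt)
  | whileDo (b : BExp) (s : Stmt)

/-- The variables that occur in an integer expression. -/
def Exp.vars : Exp → Set Var
  | .var x => {x}
  | .zero => ∅
  | .one => ∅
  | .add e₁ e₂ => e₁.vars ∪ e₂.vars
  | .sub e₁ e₂ => e₁.vars ∪ e₂.vars

/-- The variables that occur in a Boolean expression. -/
def BExp.vars : BExp → Set Var
  | .tt => ∅
  | .ff => ∅
  | .neg b => b.vars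
  | .conj b₁ b₂ => b₁.vars ∪ b₂.vars
  | .lt e₁ e₂ => e₁.vars ∪ e₂.vars
  | .eq e₁ e₂ => e₁.vars ∪ e₂.vars

/-- The variables that occur in a statement. -/
def Stmt.vars : Stmt → Set Var
  | .assign x e => {x} ∪ e.vars
  | .seq s₁ s₂ => s₁.vars ∪ s₂.vars
  | .ite b s₁ s₂ => b.vars ∪ s₁.vars ∪ s₂.vars
  | .whileDo b s => b.vars ∪ s.vars

/-! ### Terms and regular tree grammars -/

/-- The types of terms. -/
inductive Ty : Type
  | var
  | exp
  | bexp
  | stmt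

/-- The terms of each type. -/
def Term : Ty → Type
  | .var => Var
  | .exp => Exp
  | .bexp => BExp
  | .stmt => Stmt

/-- The constructors of the language. `Con w τ` are those with operand types `w` (so the arity is
the length of `w`) and result type `τ`. -/
inductive Con : List Ty → Ty → Type
  | name (x : Var) : Con [] .var
  | var : Con [.var] .exp
  | zero : Con [] .exp
  | one : Con [] .exp
  | add : Con [.exp, .exp] .exp
  | sub : Con [.exp, .exp] .exp
  | tt : Con [] .bexp
  | ff : Con [] .bexp
  | neg : Con [.bexp] .bexp
  | conj : Con [.bexp, .bexp] .bexp
  | lt : Con [.exp, .exp] .bexp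
  | eq : Con [.exp, .exp] .bexp
  | assign : Con [.var, .exp] .stmt
  | seq : Con [.stmt, .stmt] .stmt
  | ite : Con [.bexp, .stmt, .stmt] .stmt
  | whileDo : Con [.bexp, .stmt] .stmt

/-- A tuple with one entry in `F τ` for each `τ` in the list `w`. -/
abbrev Args (F : Ty → Type) (w : List Ty) : Type := ∀ i : Fin w.length, F (w.get i)

/-- The term that a constructor builds from its operands. -/
def Con.build : {w : List Ty} → {τ : Ty} → Con w τ → Args Term w → Term τ
  | _, _, .name x, _ => x
  | _, _, .var, t => Exp.var (t 0)
  | _, _, .zero, _ => Exp.zero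
  | _, _, .one, _ => Exp.one
  | _, _, .add, t => Exp.add (t 0) (t 1)
  | _, _, .sub, t => Exp.sub (t 0) (t 1)
  | _, _, .tt, _ => BExp.tt
  | _, _, .ff, _ => BExp.ff
  | _, _, .neg, t => BExp.neg (t 0)
  | _, _, .conj, t => BExp.conj (t 0) (t 1)
  | _, _, .lt, t => BExp.lt (t 0) (t 1)
  | _, _, .eq, t => BExp.eq (t 0) (t 1)
  | _, _, .assign, t => Stmt.assign (t 0) (t 1)
  | _, _, .seq, t => Stmt.seq (t 0) (t 1)
  | _, _, .ite, t => Stmt.ite (t 0) (t 1) (t 2)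
  | _, _, .whileDo, t => Stmt.whileDo (t 0) (t 1)

/-- The right-hand side `α(N_1, …, N_k)` of a production for a nonterminal of type `τ`. The
nonterminals of type `σ` form the type `NT σ`, so that every production is well typed. -/
structure Production (NT : Ty → Type) (τ : Ty) where
  dom : List Ty
  con : Con dom τ
  args : Args NT dom

/-- Typed regular tree grammars over the constructors of the language: a finite set of typed
nonterminals, a start nonterminal and, for each nonterminal, the finite list of the right-hand
sides of its productions. -/
structure Grammar where
  NT : Ty → Type
  finite : ∀ τ, Finite (NT τ)
  startTy : Ty
  start : NT startTy
  rhs : ∀ {τ}, NT τ → List (Production NT τ)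

/-- `G.Derives N t`: the term `t` is derivable from the nonterminal `N`. -/
inductive Grammar.Derives (G : Grammar) : {τ : Ty} → G.NT τ → Term τ → Prop
  | intro {τ : Ty} (N : G.NT τ) (p : Production G.NT τ) (hp : p ∈ G.rhs N) (t : Args Term p.dom)
      (ht : ∀ i, Grammar.Derives G (p.args i) (t i)) : Grammar.Derives G N (p.con.build t)

/-- The set `L(N)` of the terms derivable from `N`. -/
def Grammar.lang (G : Grammar) {τ : Ty} (N : G.NT τ) : Set (Term τ) := {t | G.Derives N t}

/-! ### Compositionality -/

/-- A semantics for sets of terms: each set of terms of type `τ` has a denotation in `D τ`. -/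
def SetSemantics (D : Ty → Type) : Type := ∀ τ : Ty, Set (Term τ) → D τ

/-- A semantics for sets of terms is compositional if there are a function `f` for each constructor
and an aggregation function `agg` on finite lists of denotations such that, for all grammars and
all nonterminals `N ::= α_1(N_{1,1}, …) | … | α_k(N_{k,1}, …)`, the denotation of `L(N)` is
`agg [f α_1 (⟦L(N_{1,1})⟧, …), …, f α_k (⟦L(N_{k,1})⟧, …)]`. -/
def IsCompositional {D : Ty → Type} (sem : SetSemantics D) : Prop :=
  ∃ (f : ∀ {w : List Ty} {τ : Ty}, Con w τ → Args D w → D τ)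
    (agg : ∀ {τ : Ty}, List (D τ) → D τ),
    ∀ (G : Grammar) (τ : Ty) (N : G.NT τ),
      sem τ (G.lang N) =
        agg ((G.rhs N).map fun p => f p.con fun i => sem (p.dom.get i) (G.lang (p.args i)))

/-! ### Semantics of single programs -/

/-- States: the values of the variables, and the reserved variables `et` and `bt` that receive the
values of integer and Boolean expressions. -/
@[ext] structure State where
  h : Var → ℤ
  et : ℤ
  bt : Bool

/-- States together with the nontermination value `none`. -/
abbrev DState : Type := Option State

/-- An integer expression stores its value in `et`. -/
def Exp.run : Exp → State → State
  | .var x, σ => { σ with et := σ.h x }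
  | .zero, σ => { σ with et := 0 }
  | .one, σ => { σ with et := 1 }
  | .add e₁ e₂, σ => { σ with et := (e₁.run σ).et + (e₂.run σ).et }
  | .sub e₁ e₂, σ => { σ with et := (e₁.run σ).et - (e₂.run σ).et }

/-- A Boolean expression stores its value in `bt`. -/
def BExp.run : BExp → State → State
  | .tt, σ => { σ with bt := true }
  | .ff, σ => { σ with bt := false }
  | .neg b, σ => { σ with bt := !(b.run σ).bt }
  | .conj b₁ b₂, σ => { σ with bt := (b₁.run σ).bt && (b₂.run σ).bt }
  | .lt e₁ e₂, σ => { σ with bt := decide ((e₁.run σ).et < (e₂.run σ).et) }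
  | .eq e₁ e₂, σ => { σ with bt := decide ((e₁.run σ).et = (e₂.run σ).et) }

/-- One round of a loop with guard `b` and body `s`: the result is `Sum.inl σ` if the loop stops in
the state `σ`, and `Sum.inr σ` if it goes on from the state `σ`. -/
def loopStep (b : State → State) (s : State →. State) : State →. State ⊕ State :=
  fun σ => bif (b σ).bt then (s σ).map Sum.inr else Part.some (Sum.inl σ)

/-- The final state of a statement, undefined if the statement does not terminate. `PFun.fix`
repeats its argument as long as that returns a value `Sum.inr σ`. -/
def Stmt.run : Stmt → State →. State
  | .assign x e => fun σ => Part.some { σ with h := Function.update σ.h x (e.run σ).et }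
  | .seq s₁ s₂ => fun σ => (s₁.run σ).bind s₂.run
  | .ite b s₁ s₂ => fun σ => bif (b.run σ).bt then s₁.run σ else s₂.run σ
  | .whileDo b s => PFun.fix (loopStep b.run s.run)

/-- Integer expressions as total maps of states with nontermination. -/
def Exp.exec (e : Exp) : DState → DState := Option.map e.run

/-- Boolean expressions as total maps of states with nontermination. -/
def BExp.exec (b : BExp) : DState → DState := Option.map b.run

open Classical in
/-- Statements as total maps of states with nontermination. -/
noncomputable def Stmt.exec (s : Stmt) (d : DState) : DState := d.bind fun σ => (s.run σ).toOption

/-! ### Vector-states -/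

/-- A sequence of states is computable if `(i, x) ↦ v[i][x]` is a computable function. -/
def ComputableSeq (v : ℕ → State) : Prop := Computable fun p : ℕ × Var => (v p.1).h p.2

/-- Extended vector-states: finite sequences of states, finite sequences of states followed by the
nontermination value, and computable infinite sequences of states. -/
inductive EVS : Type
  | fin (l : List State)
  | div (l : List State)
  | inf (v : ℕ → State) (hv : ComputableSeq v)

/-- The entries of a vector-state, counted from `0`; there is none beyond the end. -/
def EVS.entry : EVS → ℕ → Option DState
  | .fin l, i => l[i]?.map some
  | .div l, i => if i = l.length then some none else l[i]?.map some
  | .inf v _, i => some (some (v i))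

/-- `v.Occludes u`: `v = [v_1, …, v_k, ↑]`, and `u` is diverging or infinite and begins with
`v_1, …, v_k`. -/
def EVS.Occludes : EVS → EVS → Prop
  | .div l, .div m => l <+: m
  | .div l, .inf v _ => ∀ (i : ℕ) (hi : i < l.length), v i = l[i]
  | _, _ => False

/-- The reduction of a set of vector-states: each diverging or infinite vector-state is replaced by
its shortest occluder in the set (if there is one), that is, only the vector-states without an
occluder in the set other than themselves are kept. -/
def reduce (V : Set EVS) : Set EVS := {u ∈ V | ∀ v ∈ V, v.Occludes u → v = u}

/-- The result of a program on one vector-state, as a singleton: the program is applied to each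
entry, and the result is cut off after the first entry that is the nontermination value. -/
def output (g : DState → DState) (v : EVS) : Set EVS :=
  {u | ((∀ i, (v.entry i).map g ≠ some none) ∧ ∀ i, u.entry i = (v.entry i).map g) ∨
    ∃ k, (v.entry k).map g = some none ∧ (∀ i < k, (v.entry i).map g ≠ some none) ∧
      (∀ i ≤ k, u.entry i = (v.entry i).map g) ∧ ∀ i > k, u.entry i = none}

/-- The divergence-aware vector-state semantics of a program that acts on states as `g`. -/
def progSem (g : DState → DState) (V : Set EVS) : Set EVS := reduce (⋃ v ∈ V, output g v)

/-- The divergence-aware vector-state semantics of a set of programs `C`. -/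
def setSem {P : Type} (exec : P → DState → DState) (C : Set P) (V : Set EVS) : Set EVS :=
  reduce (⋃ c ∈ C, progSem (exec c) V)

/-- Denotations. A set of programs denotes a map of sets of vector-states, paired with the set of
variables of the programs; a set of variables is its own denotation. -/
def Den : Ty → Type
  | .var => Set Var
  | .exp => (Set EVS → Set EVS) × Set Var
  | .bexp => (Set EVS → Set EVS) × Set Var
  | .stmt => (Set EVS → Set EVS) × Set Var

/-- The divergence-aware vector-state semantics, paired with the sets of variables. -/
noncomputable def vectorSem : SetSemantics Den
  | .var => fun X => X
  | .exp => fun E => (setSem Exp.exec E, ⋃ e ∈ E, Exp.vars e)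
  | .bexp => fun B => (setSem BExp.exec B, ⋃ b ∈ B, BExp.vars b)
  | .stmt => fun S => (setSem Stmt.exec S, ⋃ s ∈ S, Stmt.vars s)

end GImp

namespace GImp

/-! ### Computability of integer arithmetic, memories and partial functions -/

/-! Aggregation is `reduce` of the union, since reduction absorbs inner reductions
(`reduce_biUnion_reduce`). For a constructor, `Con.den` picks any sets of terms over finitely many
variables with the given denotations and applies the constructor to them. What needs proof is
therefore a congruence: operands with equal denotations give results with equal denotations
(`vectorSem_app_congr`).

Equality or occlusion is a partial order, and every element of a set has a minimal one below it.
Hence two sets of programs have the same vector-state map exactly when, on each single vector-state,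
every output of one set is equal to or occluded by an output of the other. A finite output without
`↑` has no occluder and must be reproduced exactly. For any other output, it is enough to follow it
for a while and then diverge.

A grammar mentions finitely many variables, so its programs are partial recursive functions on some
`Mem n`. This turns the comparison into `Sim`: along every computable sequence of memories on which
`c` converges, except perhaps at the last input, some `c'` follows `c` until it possibly diverges.
In the exact mode, for finite sequences on which `c` converges, `c'` must agree throughout
(`sim_of_simulates`, `simulates_of_sim`).

Each constructor preserves `Sim`. To imitate a compound program along `x`, one collects the memories
at which an operand is called and imitates the operand along that sequence: the intermediate results
for `seq`, the inputs selecting a branch for `ite`, and for loops the concatenation of the loop-head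
memories of all runs (`Sim.whileDo`). One operand must serve all these calls at once, which is why
sequences and not single states are compared. A single nonterminating run already yields an infinite
sequence, hence the infinite vector-states. The collected sequence is computable unless some call
diverges, and then it is finite, so again computable. An imitating operand that diverges makes the
compound program diverge, which is permitted outside the exact mode; in the exact mode only finitely
many convergent calls occur, so the operands are exact too. -/

theorem encode_int_ofNat (n : ℕ) : Encodable.encode (Int.ofNat n) = 2 * n := rfl

theorem encode_int_negSucc (n : ℕ) : Encodable.encode (Int.negSucc n) = 2 * n + 1 := rfl

/-- Nonnegative integers have even codes and negative ones odd codes, so halving the code recovers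
the magnitude. -/
theorem primrec_int_toNat : Primrec Int.toNat := by
  have h : Primrec fun z : ℤ =>
      if Encodable.encode z % 2 = 0 then Encodable.encode z / 2 else 0 :=
    Primrec.ite
      (PrimrecRel.comp Primrec.eq (Primrec.nat_mod.comp Primrec.encode (Primrec.const 2))
        (Primrec.const 0))
      (Primrec.nat_div.comp Primrec.encode (Primrec.const 2)) (Primrec.const 0)
  refine h.of_eq fun z => ?_
  cases z with
  | ofNat n => rw [encode_int_ofNat]; simp
  | negSucc n => rw [encode_int_negSucc]; simp [Int.toNat]

theorem primrec_int_toNat_neg : Primrec fun z : ℤ => (-z).toNat := by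
  have h : Primrec fun z : ℤ =>
      if Encodable.encode z % 2 = 0 then 0 else (Encodable.encode z / 2) + 1 :=
    Primrec.ite
      (PrimrecRel.comp Primrec.eq (Primrec.nat_mod.comp Primrec.encode (Primrec.const 2))
        (Primrec.const 0))
      (Primrec.const 0)
      (Primrec.succ.comp (Primrec.nat_div.comp Primrec.encode (Primrec.const 2)))
  refine h.of_eq fun z => ?_
  cases z with
  | ofNat n => rw [encode_int_ofNat]; simp
  | negSucc n => rw [encode_int_negSucc]; simp [Int.neg_negSucc]; omega

theorem ofNat_int_eq (a b : ℕ) :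
    Denumerable.ofNat ℤ (if b ≤ a then 2 * (a - b) else 2 * (b - a - 1) + 1) = (a : ℤ) - b := by
  split_ifs with h
  · rw [← encode_int_ofNat, Denumerable.ofNat_encode]; simp; omega
  · rw [← encode_int_negSucc, Denumerable.ofNat_encode]; omega

theorem primrec_natCast_sub : Primrec₂ fun a b : ℕ => (a : ℤ) - b := by
  have h : Primrec fun p : ℕ × ℕ =>
      Denumerable.ofNat ℤ (if p.2 ≤ p.1 then 2 * (p.1 - p.2) else 2 * (p.2 - p.1 - 1) + 1) := by
    refine (Primrec.ofNat ℤ).comp (Primrec.ite ?_ ?_ ?_)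
    · exact Primrec.nat_le.comp Primrec.snd Primrec.fst
    · exact Primrec.nat_mul.comp (Primrec.const 2) (Primrec.nat_sub.comp Primrec.fst Primrec.snd)
    · exact Primrec.succ.comp (Primrec.nat_mul.comp (Primrec.const 2)
        (Primrec.nat_sub.comp (Primrec.nat_sub.comp Primrec.snd Primrec.fst) (Primrec.const 1)))
  exact h.of_eq fun p => ofNat_int_eq p.1 p.2

/-- An integer is the difference of `toNat` of itself and of its negative; the arithmetic is done on
natural numbers, with one signed difference at the end. -/
theorem primrec_int_add : Primrec₂ fun a b : ℤ => a + b := by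
  have h : Primrec fun p : ℤ × ℤ =>
      ((p.1.toNat + p.2.toNat : ℕ) : ℤ) - (((-p.1).toNat + (-p.2).toNat : ℕ) : ℤ) :=
    primrec_natCast_sub.comp
      (Primrec.nat_add.comp (primrec_int_toNat.comp Primrec.fst)
        (primrec_int_toNat.comp Primrec.snd))
      (Primrec.nat_add.comp (primrec_int_toNat_neg.comp Primrec.fst)
        (primrec_int_toNat_neg.comp Primrec.snd))
  exact h.of_eq fun p => by push_cast; omega

theorem primrec_int_sub : Primrec₂ fun a b : ℤ => a - b := by
  have h : Primrec fun p : ℤ × ℤ =>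
      ((p.1.toNat + (-p.2).toNat : ℕ) : ℤ) - (((-p.1).toNat + p.2.toNat : ℕ) : ℤ) :=
    primrec_natCast_sub.comp
      (Primrec.nat_add.comp (primrec_int_toNat.comp Primrec.fst)
        (primrec_int_toNat_neg.comp Primrec.snd))
      (Primrec.nat_add.comp (primrec_int_toNat_neg.comp Primrec.fst)
        (primrec_int_toNat.comp Primrec.snd))
  exact h.of_eq fun p => by push_cast; omega

theorem primrec_int_lt : Primrec₂ fun a b : ℤ => decide (a < b) := by
  have h : Primrec fun p : ℤ × ℤ => decide (0 < (p.2 - p.1).toNat) :=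
    (Primrec.nat_lt.comp (Primrec.const 0)
      (primrec_int_toNat.comp (primrec_int_sub.comp Primrec.snd Primrec.fst))).decide
  exact h.of_eq fun p => by simp

theorem primrec_int_eq : Primrec₂ fun a b : ℤ => decide (a = b) := by
  have h : Primrec fun p : ℤ × ℤ => decide (p.1 = p.2) :=
    (PrimrecRel.comp Primrec.eq Primrec.fst Primrec.snd).decide
  exact h

/-! ### Partial recursive functions with values in an option type -/

section

variable {α β γ : Type*} [Primcodable α] [Primcodable β] [Primcodable γ]

theorem computable_pi {n : ℕ} {f : α → Fin n → β} (h : ∀ i, Computable fun a => f a i) :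
    Computable f := by
  have h' : Computable fun a => (List.Vector.ofFn fun i => f a i) :=
    Computable.vector_ofFn (f := fun i a => f a i) h
  exact (Primrec.vector_get'.to_comp.comp h').of_eq fun a => by funext i; simp

theorem computable_app {n : ℕ} {f : α → Fin n → β} (h : Computable f) (i : Fin n) :
    Computable fun a => f a i :=
  Computable.fin_app.comp h (Computable.const i)

/-- The function on `Fin n` is tabulated as a list, in which a lookup out of range falls through to
the default. -/
theorem computable_dite_app {n : ℕ} {f : α → Fin n → β} {k : α → ℕ} {d : α → β}
    (hf : Computable f) (hk : Computable k) (hd : Computable d) :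
    Computable fun a => if h : k a < n then f a ⟨k a, h⟩ else d a := by
  have h1 : Computable fun a => (List.Vector.ofFn (f a)).toList[k a]? :=
    Computable.list_getElem?.comp
      (Computable.vector_toList.comp (Primrec.vector_ofFn'.to_comp.comp hf)) hk
  refine (Computable.option_getD h1 hd).of_eq fun a => ?_
  by_cases h : k a < n
  · simp [h]
  · simp [h]

/-- A partial function, given as a total function to an option type, is partial recursive. -/
def PRec (g : α → Option β) : Prop := Partrec fun a => (g a : Part β)

theorem Computable.pRec {g : α → β} (hg : Computable g) : PRec fun a => some (g a) := by
  have : Partrec fun a => Part.some (g a) := hg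
  exact this.of_eq fun a => rfl

theorem PRec.computable {g : α → Option β} (hg : PRec g) {x : γ → α} {y : γ → β}
    (hx : Computable x) (h : ∀ i, g (x i) = some (y i)) : Computable y := by
  have : Partrec fun i => (g (x i) : Part β) := hg.comp hx
  have h' : Partrec fun i => Part.some (y i) := this.of_eq fun i => by rw [h]; rfl
  exact h'

theorem PRec.bind {g : α → Option β} {f : α → β → Option γ} (hg : PRec g)
    (hf : PRec fun p : α × β => f p.1 p.2) : PRec fun a => (g a).bind (f a) := by
  have : Partrec fun a => (g a : Part β).bind fun b => (f a b : Part γ) :=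
    Partrec.bind hg hf.to₂
  refine this.of_eq fun a => ?_
  cases h : g a <;> simp [h]

theorem PRec.comp {g : α → Option β} (hg : PRec g) {x : γ → α} (hx : Computable x) :
    PRec fun c => g (x c) :=
  Partrec.comp (f := fun a => (g a : Part β)) hg hx

theorem PRec.cond {c : α → Bool} {f g : α → Option β} (hc : Computable c) (hf : PRec f)
    (hg : PRec g) : PRec fun a => bif c a then f a else g a := by
  have := Partrec.cond hc hf hg
  exact this.of_eq fun a => by cases h : c a <;> simp [h]

/-- Gaps of `x` are answered at once, and elsewhere `g` converges, so the evident partial recursive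
procedure is total. -/
theorem PRec.computable_bind {g : α → Option β} (hg : PRec g) {x : γ → Option α}
    (hx : Computable x) (h : ∀ i a, x i = some a → g a ≠ none) :
    Computable fun i => (x i).bind g := by
  have h1 : Partrec fun i => (Option.casesOn (x i) (Part.some none)
      fun a => (g a : Part β).map some : Part (Option β)) := by
    refine Partrec.optionCasesOn_right (g := fun _ a => (g a : Part β).map some) hx
      (Computable.const none) ?_
    exact (Partrec.map (Partrec.comp hg Computable.snd)
      (Computable.option_some.comp Computable.snd).to₂).to₂
  have h2 : Partrec fun i => Part.some ((x i).bind g) := by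
    refine h1.of_eq fun i => ?_
    cases hxi : x i with
    | none => rfl
    | some a =>
      have := h i a hxi
      cases hg : g a with
      | none => exact absurd hg this
      | some b => simp [hg]
  exact h2

/-- A finite table is computable, however its entries were found. This covers the sequences that a
divergence cuts off. -/
theorem computable_of_finite_support [DecidableEq α] {x : α → Option β}
    (h : {a | x a ≠ none}.Finite) : Computable x := by
  obtain ⟨s, hs⟩ := h.exists_finset
  have key : ∀ (s : Finset α) (x : α → Option β), (∀ a, a ∉ s → x a = none) → Computable x := by
    intro s
    induction s using Finset.induction_on with
    | empty =>
      intro x hx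
      exact (Computable.const none).of_eq fun a => (hx a (by simp)).symm
    | insert a s has ih =>
      intro x hx
      have h1 : Computable (Function.update x a none) := by
        refine ih _ fun b hb => ?_
        by_cases hba : b = a
        · subst hba; simp
        · simp only [Function.update_of_ne hba]
          exact hx b (by simp [hba, hb])
      have h2 : Computable fun b => decide (b = a) :=
        (PrimrecRel.comp Primrec.eq Primrec.id (Primrec.const a)).decide.to_comp.of_eq
          fun b => by simp
      refine (Computable.cond h2 (Computable.const (x a)) h1).of_eq fun b => ?_
      by_cases hba : b = a
      · subst hba; simp
      · simp [hba]
  exact key s x fun a ha => by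
    by_contra hne
    exact ha ((hs a).2 hne)

end

/-! ### Loops as partial functions -/

section Loop

variable {α β : Type*}

/-- The state before round `k` of a loop with guard `b` and body `s`. -/
def orbit (b : α → Bool) (s : α → Option α) (a : α) : ℕ → Option α
  | 0 => some a
  | k + 1 => (orbit b s a k).bind fun c => bif b c then s c else none

/-- One round of a loop, as for `loopStep`. -/
def roundStep (b : α → Bool) (s : α → Option α) (a : α) : Part (α ⊕ α) :=
  bif b a then (s a : Part α).map Sum.inr else Part.some (Sum.inl a)

open Classical in
/-- The final state of a loop with guard `b` and body `s`. -/
noncomputable def loop (b : α → Bool) (s : α → Option α) (a : α) : Option α :=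
  (PFun.fix (roundStep b s) a).toOption

variable {b b' : α → Bool} {s s' : α → Option α}

theorem orbit_succ' (b : α → Bool) (s : α → Option α) (a : α) (k : ℕ) :
    orbit b s a (k + 1) = (bif b a then s a else none).bind fun c => orbit b s c k := by
  induction k with
  | zero => simp [orbit]
  | succ k ih =>
    rw [orbit, ih]
    cases (bif b a then s a else none) <;> simp [orbit]

theorem orbit_eq_none_of_le {a : α} {k l : ℕ} (h : orbit b s a k = none) (hl : k ≤ l) :
    orbit b s a l = none := by
  induction l, hl using Nat.le_induction with
  | base => exact h
  | succ l _ ih => simp [orbit, ih]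

theorem inl_mem_roundStep {a r : α} : Sum.inl r ∈ roundStep b s a ↔ b a = false ∧ r = a := by
  unfold roundStep
  cases h : b a
  · simp
  · cases hs : s a <;> simp

theorem inr_mem_roundStep {a r : α} :
    Sum.inr r ∈ roundStep b s a ↔ b a = true ∧ s a = some r := by
  unfold roundStep
  cases h : b a
  · simp
  · cases hs : s a <;> simp [eq_comm]

/-- An orbit becomes `none` both after the guard fails and after the body diverges, so termination
is recognized by an orbit state at which the guard is false. -/
theorem loop_eq_some {a r : α} :
    loop b s a = some r ↔ ∃ k, orbit b s a k = some r ∧ b r = false := by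
  classical
  unfold loop
  rw [Part.toOption_eq_some_iff]
  constructor
  · intro h
    refine PFun.fixInduction (C := fun a => ∃ k, orbit b s a k = some r ∧ b r = false) h ?_
    · intro a h ih
      rcases PFun.mem_fix_iff.1 h with h1 | ⟨c, hc, _⟩
      · obtain ⟨h1, rfl⟩ := inl_mem_roundStep.1 h1
        exact ⟨0, rfl, h1⟩
      · obtain ⟨k, hk⟩ := ih c hc
        obtain ⟨h1, h2⟩ := inr_mem_roundStep.1 hc
        exact ⟨k + 1, by rw [orbit_succ']; simpa [h1, h2] using hk.1, hk.2⟩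
  · rintro ⟨k, hk, hr⟩
    induction k generalizing a with
    | zero =>
      simp only [orbit, Option.some.injEq] at hk
      subst hk
      exact PFun.mem_fix_iff.2 (Or.inl (inl_mem_roundStep.2 ⟨hr, rfl⟩))
    | succ k ih =>
      rw [orbit_succ'] at hk
      cases hb : b a
      · simp [hb] at hk
      · cases hs : s a with
        | none => simp [hb, hs] at hk
        | some c =>
          simp only [hb, hs, cond_true, Option.bind_some] at hk
          exact PFun.mem_fix_iff.2 (Or.inr ⟨c, inr_mem_roundStep.2 ⟨hb, hs⟩, ih hk⟩)

theorem orbit_map {b' : β → Bool} {s' : β → Option β} {φ : α → β} (hb : ∀ a, b' (φ a) = b a)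
    (hs : ∀ a, s' (φ a) = (s a).map φ) (a : α) (k : ℕ) :
    orbit b' s' (φ a) k = (orbit b s a k).map φ := by
  induction k with
  | zero => rfl
  | succ k ih =>
    rw [orbit, orbit, ih]
    cases orbit b s a k with
    | none => rfl
    | some c => cases h : b c <;> simp [hb, hs, h]

/-- With `φ := σ.merge` this transfers a loop on memories to the loop on states. -/
theorem loop_map {b' : β → Bool} {s' : β → Option β} {φ : α → β} (hb : ∀ a, b' (φ a) = b a)
    (hs : ∀ a, s' (φ a) = (s a).map φ) (a : α) :
    loop b' s' (φ a) = (loop b s a).map φ := by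
  ext r
  rw [loop_eq_some, Option.map_eq_some_iff]
  simp only [orbit_map hb hs, Option.map_eq_some_iff, loop_eq_some]
  constructor
  · rintro ⟨k, ⟨c, hc, rfl⟩, hr⟩
    exact ⟨c, ⟨k, hc, by rw [← hb]; exact hr⟩, rfl⟩
  · rintro ⟨c, ⟨k, hc, hr⟩, rfl⟩
    exact ⟨k, ⟨c, hc, rfl⟩, by rw [hb]; exact hr⟩

theorem orbit_eq_none_of_loop {a : α} (h : loop b s a ≠ none) : ∃ k, orbit b s a k = none := by
  obtain ⟨r, hr⟩ := Option.ne_none_iff_exists'.1 h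
  obtain ⟨k, hk, hb⟩ := loop_eq_some.1 hr
  exact ⟨k + 1, by simp [orbit, hk, hb]⟩

theorem loop_eq_none {a c : α} {k : ℕ} (hk : orbit b s a k = some c) (hb : b c = true)
    (hs : s c = none) : loop b s a = none := by
  by_contra h
  obtain ⟨r, hr⟩ := Option.ne_none_iff_exists'.1 h
  obtain ⟨l, hl, hr⟩ := loop_eq_some.1 hr
  have hk1 : orbit b s a (k + 1) = none := by simp [orbit, hk, hb, hs]
  rcases lt_trichotomy l k with h | rfl | h
  · have : orbit b s a (l + 1) = none := by simp [orbit, hl, hr]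
    rw [orbit_eq_none_of_le this h] at hk
    cases hk
  · rw [hl] at hk
    cases hk
    rw [hb] at hr
    cases hr
  · rw [orbit_eq_none_of_le hk1 h] at hl
    cases hl

theorem loop_congr {a : α} (h : ∀ k, orbit b' s' a k = orbit b s a k)
    (hb : ∀ k c, orbit b s a k = some c → b' c = b c) : loop b' s' a = loop b s a := by
  ext r
  rw [loop_eq_some, loop_eq_some]
  constructor
  · rintro ⟨k, hk, hr⟩
    rw [h] at hk
    exact ⟨k, hk, by rw [← hb k r hk]; exact hr⟩
  · rintro ⟨k, hk, hr⟩
    exact ⟨k, by rw [h]; exact hk, by rw [hb k r hk]; exact hr⟩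

/-- Only rounds before `k` matter, and the bodies only where the guard holds: an imitating body is
compared with the original nowhere else. -/
theorem orbit_congr {a : α} {k : ℕ}
    (hb : ∀ l < k, ∀ c, orbit b s a l = some c → b' c = b c)
    (hs : ∀ l < k, ∀ c, orbit b s a l = some c → b c = true → s' c = s c) :
    orbit b' s' a k = orbit b s a k := by
  induction k with
  | zero => rfl
  | succ k ih =>
    rw [orbit, orbit, ih (fun l hl => hb l (by omega)) (fun l hl => hs l (by omega))]
    cases h : orbit b s a k with
    | none => rfl
    | some c =>
      cases h' : b c with
      | false => simp [hb k (by omega) c h, h']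
      | true => simp [hb k (by omega) c h, h', hs k (by omega) c h h']

end Loop

/-! ### Computability of loops and of their orbits -/

section

variable {α : Type*} [Primcodable α]

theorem PRec.loop {b : α → Bool} {s : α → Option α} (hb : Computable b) (hs : PRec s) :
    PRec (loop b s) := by
  classical
  have h1 : Partrec fun a => (s a : Part α).map (Sum.inr : α → α ⊕ α) :=
    Partrec.map hs (Computable.sumInr.comp Computable.snd).to₂
  have h2 : Partrec (PFun.fix (roundStep b s)) :=
    Partrec.fix (Partrec.cond hb h1 (Computable.sumInl (α := α) (β := α)).partrec)
  refine Partrec.of_eq h2 fun a => ?_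
  unfold GImp.loop
  rw [Part.of_toOption]

/-- Every call of the body converges by `h`, so each round is a total computation, even along a run
that never stops. -/
theorem computable_orbit {γ : Type*} [Primcodable γ] {b : α → Bool} {s : α → Option α}
    (hb : Computable b) (hs : PRec s) {x : γ → Option α} (hx : Computable x)
    (h : ∀ i a k c, x i = some a → orbit b s a k = some c → b c = true → s c ≠ none) :
    Computable fun p : γ × ℕ => (x p.1).bind fun a => orbit b s a p.2 := by
  have hstep : Partrec fun o : Option α => (Option.casesOn o (Part.some none) fun c =>
      bif b c then (s c : Part α).map some else Part.some none : Part (Option α)) := by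
    refine Partrec.optionCasesOn_right
      (g := fun _ c => bif b c then (s c : Part α).map some else Part.some none) Computable.id
      (Computable.const none) ?_
    exact (Partrec.cond (hb.comp Computable.snd)
      (Partrec.map (Partrec.comp hs Computable.snd)
        (Computable.option_some.comp Computable.snd).to₂)
      (Computable.const none)).to₂
  have hrec := Partrec.nat_rec (f := fun p : γ × ℕ => p.2) (g := fun p : γ × ℕ => Part.some (x p.1))
    (h := fun (_ : γ × ℕ) (q : ℕ × Option α) =>
      (Option.casesOn q.2 (Part.some none) fun c =>
        bif b c then (s c : Part α).map some else Part.some none : Part (Option α)))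
    Computable.snd (hx.comp Computable.fst)
    (hstep.comp (Computable.snd.comp Computable.snd)).to₂
  refine Partrec.of_eq hrec fun p => ?_
  obtain ⟨i, k⟩ := p
  change _ = Part.some _
  dsimp only
  induction k with
  | zero => cases x i <;> rfl
  | succ k ih =>
    dsimp only
    rw [ih, Part.bind_some]
    cases hxi : x i with
    | none => rfl
    | some a =>
      simp only [Option.bind_some, orbit]
      cases ho : orbit b s a k with
      | none => rfl
      | some c =>
        cases hbc : b c with
        | false => simp [hbc]
        | true =>
          obtain ⟨d, hd⟩ := Option.ne_none_iff_exists'.1 (h i a k c hxi ho hbc)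
          simp [hbc, hd]

end

/-! ### Programs as partial recursive functions on memories of finitely many variables -/

/-- Memories for the variables below `n`. -/
abbrev Mem (n : ℕ) : Type := Fin n → ℤ

/-- The memory for the variables below `n` of a state. -/
def State.restrict (n : ℕ) (σ : State) : Mem n := fun i => σ.h i

/-- Overwrites the variables below `n` of a state. -/
def State.merge {n : ℕ} (σ : State) (m : Mem n) : State :=
  { σ with h := fun x => if hx : x < n then m ⟨x, hx⟩ else σ.h x }

/-- The state with the given memory in which everything else is zero. -/
def Mem.toState {n : ℕ} (m : Mem n) : State := State.merge ⟨fun _ => 0, 0, false⟩ m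

section

variable {n : ℕ}

theorem State.restrict_merge (σ : State) (m : Mem n) : (σ.merge m).restrict n = m := by
  funext i
  simp [State.restrict, State.merge]

theorem Mem.restrict_toState (m : Mem n) : m.toState.restrict n = m :=
  State.restrict_merge _ _

theorem State.merge_restrict (σ : State) : σ.merge (σ.restrict n) = σ := by
  ext x <;> simp [State.restrict, State.merge]

theorem State.merge_merge (σ : State) (m m' : Mem n) : (σ.merge m).merge m' = σ.merge m' := by
  ext x
  · by_cases h : x < n <;> simp [State.merge, h]
  · rfl
  · rfl

theorem State.merge_injective (σ : State) : Function.Injective (σ.merge (n := n)) := by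
  intro m m' h
  rw [← σ.restrict_merge m, h, σ.restrict_merge]

/-- The value of an integer expression over the variables below `n`. -/
def Exp.fn (n : ℕ) : Exp → Mem n → ℤ
  | .var x, m => if h : x < n then m ⟨x, h⟩ else 0
  | .zero, _ => 0
  | .one, _ => 1
  | .add e₁ e₂, m => e₁.fn n m + e₂.fn n m
  | .sub e₁ e₂, m => e₁.fn n m - e₂.fn n m

/-- The value of a Boolean expression over the variables below `n`. -/
def BExp.fn (n : ℕ) : BExp → Mem n → Bool
  | .tt, _ => true
  | .ff, _ => false
  | .neg b, m => !b.fn n m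
  | .conj b₁ b₂, m => b₁.fn n m && b₂.fn n m
  | .lt e₁ e₂, m => decide (e₁.fn n m < e₂.fn n m)
  | .eq e₁ e₂, m => decide (e₁.fn n m = e₂.fn n m)

/-- The final memory of a statement over the variables below `n`. -/
noncomputable def Stmt.fn (n : ℕ) : Stmt → Mem n → Option (Mem n)
  | .assign x e, m => some fun i => bif decide (i.val = x) then e.fn n m else m i
  | .seq s₁ s₂, m => (s₁.fn n m).bind (s₂.fn n)
  | .ite b s₁ s₂, m => bif b.fn n m then s₁.fn n m else s₂.fn n m
  | .whileDo b s, m => loop (b.fn n) (s.fn n) m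

theorem Exp.run_eq {e : Exp} (he : e.vars ⊆ {x | x < n}) (σ : State) :
    e.run σ = { σ with et := e.fn n (σ.restrict n) } := by
  induction e with
  | var x =>
    have : x < n := he rfl
    simp [Exp.run, Exp.fn, this, State.restrict]
  | zero => rfl
  | one => rfl
  | add e₁ e₂ h₁ h₂ =>
    have := Set.union_subset_iff.1 he
    simp [Exp.run, Exp.fn, h₁ this.1, h₂ this.2]
  | sub e₁ e₂ h₁ h₂ =>
    have := Set.union_subset_iff.1 he
    simp [Exp.run, Exp.fn, h₁ this.1, h₂ this.2]

theorem BExp.run_eq {b : BExp} (hb : b.vars ⊆ {x | x < n}) (σ : State) :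
    b.run σ = { σ with bt := b.fn n (σ.restrict n) } := by
  induction b with
  | tt => rfl
  | ff => rfl
  | neg b h => simp [BExp.run, BExp.fn, h hb]
  | conj b₁ b₂ h₁ h₂ =>
    have := Set.union_subset_iff.1 hb
    simp [BExp.run, BExp.fn, h₁ this.1, h₂ this.2]
  | lt e₁ e₂ =>
    have := Set.union_subset_iff.1 hb
    simp [BExp.run, BExp.fn, Exp.run_eq this.1, Exp.run_eq this.2]
  | eq e₁ e₂ =>
    have := Set.union_subset_iff.1 hb
    simp [BExp.run, BExp.fn, Exp.run_eq this.1, Exp.run_eq this.2]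

theorem Stmt.exec_eq_some {s : Stmt} {σ τ : State} :
    s.exec (some σ) = some τ ↔ τ ∈ s.run σ := by
  classical
  simp only [Stmt.exec, Option.bind_some]
  exact Part.toOption_eq_some_iff

theorem Stmt.ofOption_exec (s : Stmt) (σ : State) : (s.exec (some σ) : Part State) = s.run σ := by
  ext τ
  rw [Part.mem_ofOption, Option.mem_def, Stmt.exec_eq_some]

theorem Stmt.exec_seq (s₁ s₂ : Stmt) (σ : State) :
    (Stmt.seq s₁ s₂).exec (some σ) = s₂.exec (s₁.exec (some σ)) := by
  ext τ
  rw [Stmt.exec_eq_some]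
  change τ ∈ (s₁.run σ).bind s₂.run ↔ _
  refine Part.mem_bind_iff.trans ?_
  constructor
  · rintro ⟨ρ, h₁, h₂⟩
    rw [Stmt.exec_eq_some.2 h₁, Stmt.exec_eq_some]
    exact h₂
  · cases h : s₁.exec (some σ) with
    | none => intro h'; cases h'
    | some ρ => exact fun h' => ⟨ρ, Stmt.exec_eq_some.1 h, Stmt.exec_eq_some.1 h'⟩

theorem Stmt.exec_ite (b : BExp) (s₁ s₂ : Stmt) (σ : State) :
    (Stmt.ite b s₁ s₂).exec (some σ) =
      bif (b.run σ).bt then s₁.exec (some σ) else s₂.exec (some σ) := by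
  ext τ
  rw [Stmt.exec_eq_some]
  change τ ∈ (bif (b.run σ).bt then s₁.run σ else s₂.run σ) ↔ _
  cases (b.run σ).bt
  · exact Stmt.exec_eq_some.symm
  · exact Stmt.exec_eq_some.symm

theorem Stmt.exec_whileDo (b : BExp) (s : Stmt) (σ : State) :
    (Stmt.whileDo b s).exec (some σ) =
      loop (fun τ => (b.run τ).bt) (fun τ => s.exec (some τ)) σ := by
  classical
  have h : loopStep b.run s.run =
      roundStep (fun τ => (b.run τ).bt) (fun τ => s.exec (some τ)) := by
    funext τ
    simp only [loopStep, roundStep, Stmt.ofOption_exec]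
  ext τ
  rw [Stmt.exec_eq_some, Stmt.run, h, loop]
  exact Part.toOption_eq_some_iff.symm

theorem Stmt.exec_eq {s : Stmt} (hs : s.vars ⊆ {x | x < n}) (σ : State) :
    s.exec (some σ) = (s.fn n (σ.restrict n)).map σ.merge := by
  induction s generalizing σ with
  | assign x e =>
    have he : e.vars ⊆ {x | x < n} := fun y hy => hs (Or.inr hy)
    have hx : x < n := hs (Or.inl rfl)
    rw [Stmt.fn, Option.map_some, Stmt.exec_eq_some, Stmt.run, Part.mem_some_iff, Exp.run_eq he]
    ext y
    · by_cases hyx : y = x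
      · subst hyx; simp [State.merge, hx]
      · by_cases hy : y < n <;> simp [State.merge, hyx, hy, State.restrict]
    · rfl
    · rfl
  | seq s₁ s₂ h₁ h₂ =>
    have := Set.union_subset_iff.1 hs
    rw [Stmt.exec_seq, h₁ this.1, Stmt.fn]
    cases s₁.fn n (σ.restrict n) with
    | none => rfl
    | some m =>
      simp only [Option.map_some, Option.bind_some]
      rw [h₂ this.2, State.restrict_merge]
      congr 1
      funext m'
      exact State.merge_merge _ _ _
  | ite b s₁ s₂ h₁ h₂ =>
    have := Set.union_subset_iff.1 hs
    have h' := Set.union_subset_iff.1 this.1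
    rw [Stmt.exec_ite, h₁ h'.2, h₂ this.2, BExp.run_eq h'.1, Stmt.fn]
    dsimp only
    cases b.fn n (σ.restrict n) <;> rfl
  | whileDo b s h =>
    have := Set.union_subset_iff.1 hs
    rw [Stmt.exec_whileDo, Stmt.fn]
    have := loop_map (b := b.fn n) (s := s.fn n) (b' := fun τ => (b.run τ).bt)
      (s' := fun τ => s.exec (some τ)) (φ := σ.merge (n := n))
      (fun m => by rw [BExp.run_eq this.1, State.restrict_merge])
      (fun m => by
        rw [h this.2, State.restrict_merge]
        congr 1
        funext m'
        exact State.merge_merge _ _ _) (σ.restrict n)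
    rw [State.merge_restrict] at this
    exact this

theorem Exp.computable_fn (e : Exp) : Computable (e.fn n) := by
  induction e with
  | var x => exact computable_dite_app Computable.id (Computable.const x) (Computable.const 0)
  | zero => exact Computable.const 0
  | one => exact Computable.const 1
  | add e₁ e₂ h₁ h₂ => exact primrec_int_add.to_comp.comp h₁ h₂
  | sub e₁ e₂ h₁ h₂ => exact primrec_int_sub.to_comp.comp h₁ h₂

theorem BExp.computable_fn (b : BExp) : Computable (b.fn n) := by
  induction b with
  | tt => exact Computable.const true
  | ff => exact Computable.const false
  | neg b h => exact Primrec.not.to_comp.comp h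
  | conj b₁ b₂ h₁ h₂ => exact Primrec.and.to_comp.comp h₁ h₂
  | lt e₁ e₂ => exact primrec_int_lt.to_comp.comp e₁.computable_fn e₂.computable_fn
  | eq e₁ e₂ => exact primrec_int_eq.to_comp.comp e₁.computable_fn e₂.computable_fn

theorem Stmt.pRec_fn (s : Stmt) : PRec (s.fn n) := by
  induction s with
  | assign x e =>
    refine Computable.pRec (computable_pi fun i => ?_)
    exact Computable.cond (Computable.const _) e.computable_fn
      (computable_app Computable.id i)
  | seq s₁ s₂ h₁ h₂ => exact PRec.bind h₁ (PRec.comp h₂ Computable.snd)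
  | ite b s₁ s₂ h₁ h₂ => exact PRec.cond b.computable_fn h₁ h₂
  | whileDo b s h => exact PRec.loop b.computable_fn h

/-- The programs in `C` act on states through the partial recursive functions `fn c` of the memory
for the variables below `n`; `put` stores the result. -/
structure IsModel {P R : Type} [Primcodable R] (exec : P → DState → DState)
    (fn : P → Mem n → Option R) (put : State → R → State) (C : Set P) : Prop where
  exec_none : ∀ c, exec c none = none
  exec_some : ∀ c ∈ C, ∀ σ, exec c (some σ) = (fn c (σ.restrict n)).map (put σ)
  put_injective : ∀ σ, Function.Injective (put σ)
  put_computable : ∀ (v : ℕ → State) (r : ℕ → R), ComputableSeq v → Computable r →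
    ComputableSeq fun i => put (v i) (r i)
  pRec : ∀ c, PRec (fn c)

theorem Exp.isModel {C : Set Exp} (hC : ∀ e ∈ C, e.vars ⊆ {x | x < n}) :
    IsModel Exp.exec (fun e (m : Mem n) => some (e.fn n m)) (fun σ z => { σ with et := z }) C where
  exec_none _ := rfl
  exec_some e he σ := by simp [Exp.exec, Exp.run_eq (hC e he)]
  put_injective σ z z' h := congrArg State.et h
  put_computable _ _ hv _ := hv
  pRec e := Computable.pRec e.computable_fn

theorem BExp.isModel {C : Set BExp} (hC : ∀ b ∈ C, b.vars ⊆ {x | x < n}) :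
    IsModel BExp.exec (fun b (m : Mem n) => some (b.fn n m)) (fun σ z => { σ with bt := z }) C where
  exec_none _ := rfl
  exec_some b hb σ := by simp [BExp.exec, BExp.run_eq (hC b hb)]
  put_injective σ z z' h := congrArg State.bt h
  put_computable _ _ hv _ := hv
  pRec b := Computable.pRec b.computable_fn

theorem Stmt.isModel {C : Set Stmt} (hC : ∀ s ∈ C, s.vars ⊆ {x | x < n}) :
    IsModel Stmt.exec (Stmt.fn n) State.merge C where
  exec_none _ := rfl
  exec_some s hs σ := Stmt.exec_eq (hC s hs) σ
  put_injective := State.merge_injective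
  put_computable _ r hv hr :=
    computable_dite_app (f := fun p : ℕ × Var => r p.1) (hr.comp Computable.fst) Computable.snd hv
  pRec := Stmt.pRec_fn

theorem computableSeq_toState {x : ℕ → Mem n} (hx : Computable x) :
    ComputableSeq fun i => (x i).toState :=
  computable_dite_app (f := fun p : ℕ × Var => x p.1) (hx.comp Computable.fst) Computable.snd
    (Computable.const 0)

theorem computable_restrict {v : ℕ → State} (hv : ComputableSeq v) :
    Computable fun i => (v i).restrict n :=
  computable_pi fun i => Computable.comp hv (Computable.pair Computable.id (Computable.const i.val))

end

/-! ### The occlusion order on vector-states -/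

/-- `v` is `u` or occludes it. -/
def EVS.Below (v u : EVS) : Prop := v = u ∨ v.Occludes u

theorem EVS.Occludes.trans {u v w : EVS} (h₁ : u.Occludes v) (h₂ : v.Occludes w) :
    u.Occludes w := by
  cases u <;> cases v <;> cases w <;> simp only [EVS.Occludes] at *
  · exact h₁.trans h₂
  · rename_i l m _ _
    intro i hi
    have := h₁.length_le
    rw [h₂ i (by omega), h₁.getElem hi]

theorem EVS.Occludes.antisymm {u v : EVS} (h₁ : u.Occludes v) (h₂ : v.Occludes u) : u = v := by
  cases u <;> cases v <;> simp only [EVS.Occludes] at *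
  rw [h₁.eq_of_length (le_antisymm h₁.length_le h₂.length_le)]

theorem EVS.Below.trans {u v w : EVS} (h₁ : u.Below v) (h₂ : v.Below w) : u.Below w := by
  rcases h₁ with rfl | h₁
  · exact h₂
  · rcases h₂ with rfl | h₂
    · exact Or.inr h₁
    · exact Or.inr (h₁.trans h₂)

theorem EVS.Below.antisymm {u v : EVS} (h₁ : u.Below v) (h₂ : v.Below u) : u = v := by
  rcases h₁ with rfl | h₁
  · rfl
  · rcases h₂ with rfl | h₂
    · rfl
    · exact h₁.antisymm h₂

theorem mem_reduce {U : Set EVS} {u : EVS} :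
    u ∈ reduce U ↔ u ∈ U ∧ ∀ v ∈ U, v.Below u → v = u := by
  refine and_congr_right fun _ => forall₂_congr fun v _ => ?_
  constructor
  · rintro h (h' | h')
    · exact h'
    · exact h h'
  · exact fun h h' => h (Or.inr h')

/-- Every occluder is a `div`, and a proper occluder of a `div` is shorter, so descent on the length
reaches an unoccluded element. -/
theorem exists_reduce_below {U : Set EVS} {u : EVS} (hu : u ∈ U) :
    ∃ v ∈ reduce U, v.Below u := by
  have key : ∀ (k : ℕ) (l : List State), l.length = k → EVS.div l ∈ U →
      ∃ v ∈ reduce U, v.Below (EVS.div l) := by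
    intro k
    induction k using Nat.strong_induction_on with
    | _ k ih =>
      rintro l rfl hl
      by_cases h : EVS.div l ∈ reduce U
      · exact ⟨_, h, Or.inl rfl⟩
      · have : ∃ v ∈ U, v.Occludes (EVS.div l) ∧ v ≠ EVS.div l := by
          by_contra hne
          push Not at hne
          exact h ⟨hl, hne⟩
        obtain ⟨v, hv, ho, hne⟩ := this
        cases v with
        | div m =>
          have hm : m.length < l.length := by
            refine lt_of_le_of_ne ho.length_le fun h => hne ?_
            rw [List.IsPrefix.eq_of_length ho h]
          obtain ⟨w, hw, hwm⟩ := ih _ hm m rfl hv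
          exact ⟨w, hw, hwm.trans (Or.inr ho)⟩
        | fin m => exact ho.elim
        | inf m hm => exact ho.elim
  by_cases h : u ∈ reduce U
  · exact ⟨_, h, Or.inl rfl⟩
  · have : ∃ v ∈ U, v.Occludes u := by
      by_contra hne
      push Not at hne
      exact h ⟨hu, fun v hv ho => (hne v hv ho).elim⟩
    obtain ⟨v, hv, ho⟩ := this
    cases v with
    | div m =>
      obtain ⟨w, hw, hwm⟩ := key _ m rfl hv
      exact ⟨w, hw, hwm.trans (Or.inr ho)⟩
    | fin m => exact ho.elim
    | inf m hm => exact ho.elim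

/-- Each element of `U` is in `U'` or occluded by an element of `U'`. -/
def Covered (U U' : Set EVS) : Prop := ∀ u ∈ U, ∃ v ∈ U', v.Below u

theorem covered_of_subset {U U' : Set EVS} (h : U ⊆ U') : Covered U U' :=
  fun u hu => ⟨u, h hu, Or.inl rfl⟩

theorem reduce_subset (U : Set EVS) : reduce U ⊆ U := fun _ h => h.1

/-- Below a minimal `u` lies some `v ∈ U'`, and below that some `w ∈ U`. Minimality gives `w = u`,
and antisymmetry gives `v = u`. -/
theorem reduce_subset_of_covered {U U' : Set EVS} (h : Covered U U') (h' : Covered U' U) :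
    reduce U ⊆ reduce U' := by
  intro u hu
  rw [mem_reduce] at hu
  obtain ⟨v, hv, hvu⟩ := h u hu.1
  obtain ⟨w, hw, hwv⟩ := h' v hv
  have hwu := hu.2 w hw (hwv.trans hvu)
  subst hwu
  have hvw := hvu.antisymm hwv
  subst hvw
  refine mem_reduce.2 ⟨hv, fun z hz hzu => ?_⟩
  obtain ⟨y, hy, hyz⟩ := h' z hz
  have := hu.2 y hy (hyz.trans hzu)
  subst this
  exact hzu.antisymm hyz

theorem reduce_eq_of_covered {U U' : Set EVS} (h : Covered U U') (h' : Covered U' U) :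
    reduce U = reduce U' :=
  (reduce_subset_of_covered h h').antisymm (reduce_subset_of_covered h' h)

theorem reduce_biUnion_reduce {ι : Type*} (S : Set ι) (U : ι → Set EVS) :
    reduce (⋃ i ∈ S, reduce (U i)) = reduce (⋃ i ∈ S, U i) := by
  refine reduce_eq_of_covered
    (covered_of_subset (Set.iUnion₂_mono fun i _ => reduce_subset (U i))) fun u hu => ?_
  obtain ⟨i, hi, hu⟩ := Set.mem_iUnion₂.1 hu
  obtain ⟨v, hv, hvu⟩ := exists_reduce_below hu
  exact ⟨v, Set.mem_iUnion₂.2 ⟨i, hi, hv⟩, hvu⟩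

/-! ### Sets of programs and the vector-states they produce -/

/-- All vector-states that programs in `C` produce from vector-states in `V`. -/
def outputs {P : Type} (exec : P → DState → DState) (C : Set P) (V : Set EVS) : Set EVS :=
  ⋃ c ∈ C, ⋃ v ∈ V, output (exec c) v

theorem setSem_eq {P : Type} (exec : P → DState → DState) (C : Set P) (V : Set EVS) :
    setSem exec C V = reduce (outputs exec C V) :=
  reduce_biUnion_reduce C fun c => ⋃ v ∈ V, output (exec c) v

/-- Each result of a program in `C` is matched or occluded by a result of a program in `C'` on the
same vector-state. -/
def Simulates {P : Type} (exec : P → DState → DState) (C C' : Set P) : Prop :=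
  ∀ v, ∀ c ∈ C, ∀ u ∈ output (exec c) v, ∃ c' ∈ C', ∃ u' ∈ output (exec c') v, u'.Below u

/-- Testing on the singleton `{v}` ensures that the matching output comes from the same input. -/
theorem simulates_of_setSem_eq {P : Type} {exec : P → DState → DState} {C C' : Set P}
    (h : setSem exec C = setSem exec C') : Simulates exec C C' := by
  intro v c hc u hu
  have hu' : u ∈ outputs exec C {v} := by
    simp only [outputs, Set.mem_iUnion]
    exact ⟨c, hc, v, rfl, hu⟩
  obtain ⟨w, hw, hwu⟩ := exists_reduce_below hu'
  rw [← setSem_eq, h, setSem_eq] at hw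
  have := reduce_subset _ hw
  simp only [outputs, Set.mem_iUnion] at this
  obtain ⟨c', hc', v', rfl, hw'⟩ := this
  exact ⟨c', hc', w, hw', hwu⟩

theorem Simulates.covered {P : Type} {exec : P → DState → DState} {C C' : Set P}
    (h : Simulates exec C C') (V : Set EVS) : Covered (outputs exec C V) (outputs exec C' V) := by
  intro u hu
  simp only [outputs, Set.mem_iUnion] at hu
  obtain ⟨c, hc, v, hv, hu⟩ := hu
  obtain ⟨c', hc', u', hu', hb⟩ := h v c hc u hu
  refine ⟨u', ?_, hb⟩
  simp only [outputs, Set.mem_iUnion]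
  exact ⟨c', hc', v, hv, hu'⟩

theorem setSem_eq_of_simulates {P : Type} {exec : P → DState → DState} {C C' : Set P}
    (h : Simulates exec C C') (h' : Simulates exec C' C) : setSem exec C = setSem exec C' := by
  funext V
  rw [setSem_eq, setSem_eq]
  exact reduce_eq_of_covered (h.covered V) (h'.covered V)

theorem setSem_iUnion {P ι : Type} (exec : P → DState → DState) (S : Set ι) (C : ι → Set P)
    (V : Set EVS) :
    setSem exec (⋃ i ∈ S, C i) V = reduce (⋃ i ∈ S, setSem exec (C i) V) := by
  simp only [setSem_eq]
  rw [reduce_biUnion_reduce]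
  congr 1
  simp only [outputs]
  ext u
  simp only [Set.mem_iUnion]
  constructor
  · rintro ⟨c, ⟨i, hi, hc⟩, h⟩
    exact ⟨i, hi, c, hc, h⟩
  · rintro ⟨i, hi, c, hc, h⟩
    exact ⟨c, ⟨i, hi, hc⟩, h⟩

/-! ### Entries of vector-states -/

theorem EVS.entry_none_of_le {v : EVS} {i j : ℕ} (h : v.entry i = none) (hij : i ≤ j) :
    v.entry j = none := by
  cases v with
  | fin l => simp [EVS.entry] at h ⊢; omega
  | div l =>
    by_cases hi : i = l.length
    · simp [EVS.entry, hi] at h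
    · have h' : l.length ≤ i := by simpa [EVS.entry, hi] using h
      have : j ≠ l.length := by omega
      simp [EVS.entry, this]; omega
  | inf w hw => simp [EVS.entry] at h

/-- Occlusion entry by entry, where `k` is the position of `↑` in the occluder. -/
theorem EVS.Occludes.exists_entry {v u : EVS} (h : v.Occludes u) :
    ∃ k, v.entry k = some none ∧ (∀ i < k, v.entry i = u.entry i) ∧ u.entry k ≠ none ∧
      ∀ l, u ≠ .fin l := by
  cases v with
  | fin l => exact h.elim
  | inf w hw => exact h.elim
  | div l =>
    cases u with
    | fin m => exact h.elim
    | div m =>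
      have h : l <+: m := h
      have hlen := h.length_le
      refine ⟨l.length, by simp [EVS.entry], fun i hi => ?_, ?_, by simp⟩
      · have h1 : i ≠ l.length := by omega
        have h2 : i ≠ m.length := by omega
        have h3 : i < m.length := by omega
        simp only [EVS.entry, h1, h2, if_false]
        rw [List.getElem?_eq_getElem hi, List.getElem?_eq_getElem h3, h.getElem hi]
      · by_cases hl : l.length = m.length
        · simp [EVS.entry, hl]
        · have : l.length < m.length := by omega
          simp [EVS.entry, hl, this]
    | inf w hw =>
      refine ⟨l.length, by simp [EVS.entry], fun i hi => ?_, by simp [EVS.entry], by simp⟩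
      have h1 : i ≠ l.length := by omega
      have h2 := h i hi
      simp [EVS.entry, h1, hi, h2]

theorem EVS.occludes_of_entry {v u : EVS} {k : ℕ} (hk : v.entry k = some none)
    (hi : ∀ i < k, v.entry i = u.entry i) (hu : u.entry k ≠ none) (hfin : ∀ l, u ≠ .fin l) :
    v.Occludes u := by
  cases v with
  | fin l => cases hl : l[k]? <;> simp [EVS.entry, hl] at hk
  | inf w hw => simp [EVS.entry] at hk
  | div l =>
    have hkl : k = l.length := by
      by_contra hne
      cases hl : l[k]? <;> simp [EVS.entry, hne, hl] at hk
    subst hkl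
    cases u with
    | fin m => exact (hfin m rfl).elim
    | div m =>
      have hlen : l.length ≤ m.length := by
        by_contra hne
        have h1 : l.length ≠ m.length := by omega
        have h2 : m.length ≤ l.length := by omega
        simp [EVS.entry, h1, h2] at hu
      change l <+: m
      rw [List.prefix_iff_getElem?]
      intro i hil
      have := hi i hil
      have h1 : i ≠ l.length := by omega
      have h2 : i ≠ m.length := by omega
      simp only [EVS.entry, h1, h2, if_false] at this
      rw [← Option.map_injective (Option.some_injective _) this, List.getElem?_eq_getElem hil]
    | inf w hw =>
      intro i hil
      have := hi i hil
      have h1 : i ≠ l.length := by omega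
      simpa [EVS.entry, h1, hil] using this.symm

theorem output_entry {g : DState → DState} {v u : EVS} (hu : u ∈ output g v) {i : ℕ}
    (hi : ∀ j < i, (v.entry j).map g ≠ some none) : u.entry i = (v.entry i).map g := by
  rcases hu with ⟨_, h⟩ | ⟨k, hk, _, h, _⟩
  · exact h i
  · refine h i (not_lt.1 fun hki => hi k hki hk)

theorem output_congr {g g' : DState → DState} {v : EVS}
    (h : ∀ i, (v.entry i).map g' = (v.entry i).map g) : output g' v = output g v := by
  simp only [output, h]

/-! ### Outputs of programs that are partial recursive on memories -/

section

variable {n : ℕ} {P R : Type} [Primcodable R] {exec : P → DState → DState}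
  {fn : P → Mem n → Option R} {put : State → R → State} {C C' : Set P}

theorem IsModel.exec_eq_iff (h : IsModel exec fn put C) {c c' : P} (hc : c ∈ C) (hc' : c' ∈ C)
    (σ : State) : exec c' (some σ) = exec c (some σ) ↔
      fn c' (σ.restrict n) = fn c (σ.restrict n) := by
  rw [h.exec_some c hc, h.exec_some c' hc']
  exact (Option.map_injective (h.put_injective σ)).eq_iff

theorem IsModel.exec_eq_none_iff (h : IsModel exec fn put C) {c : P} (hc : c ∈ C)
    (σ : State) : exec c (some σ) = none ↔ fn c (σ.restrict n) = none := by
  rw [h.exec_some c hc, Option.map_eq_none_iff]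

/-- The case that needs the model is an infinite input without divergence: the output must again be
computable, and it is because `fn c` is partial recursive and defined along the whole input. -/
theorem IsModel.output_nonempty (h : IsModel exec fn put C) {c : P} (hc : c ∈ C) (v : EVS) :
    (output (exec c) v).Nonempty := by
  by_cases hd : ∃ k, (v.entry k).map (exec c) = some none
  · classical
    have hk := Nat.find_spec hd
    have hlt : ∀ i < Nat.find hd, (v.entry i).map (exec c) ≠ some none :=
      fun i hi => Nat.find_min hd hi
    set k := Nat.find hd
    have hsome : ∀ i < k, ∃ τ, (v.entry i).map (exec c) = some (some τ) := by
      intro i hi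
      cases hv : v.entry i with
      | none => rw [EVS.entry_none_of_le hv hi.le] at hk; cases hk
      | some d =>
        cases hτ : exec c d with
        | none => exact absurd (by simp [hv, hτ]) (hlt i hi)
        | some τ => exact ⟨τ, by simp [hτ]⟩
    choose τ hτ using hsome
    refine ⟨.div (List.ofFn fun i : Fin k => τ i i.2), Or.inr ⟨k, hk, hlt, fun i hi => ?_,
      fun i hi => ?_⟩⟩
    · rcases hi.lt_or_eq with hi | rfl
      · have h1 : i ≠ k := by omega
        rw [hτ i hi]
        simp [EVS.entry, h1, hi]
      · rw [hk]
        simp [EVS.entry]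
    · have h1 : i ≠ k := by omega
      have h2 : k ≤ i := by omega
      simp [EVS.entry, h1, h2]
  · push Not at hd
    cases v with
    | fin l =>
      have hex : ∀ σ ∈ l, ∃ τ, exec c (some σ) = some τ := by
        intro σ hσ
        obtain ⟨i, hi, rfl⟩ := List.mem_iff_getElem.1 hσ
        refine Option.ne_none_iff_exists'.1 fun h' => hd i ?_
        simp [EVS.entry, hi, h']
      -- The default of `getD` is never used, by `hex`.
      refine ⟨.fin (l.map fun σ => (exec c (some σ)).getD σ), Or.inl ⟨hd, fun i => ?_⟩⟩
      cases hl : l[i]? with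
      | none => simp [EVS.entry, hl]
      | some σ =>
        obtain ⟨τ, hτ⟩ := hex σ (List.mem_of_getElem? hl)
        simp [EVS.entry, hl, hτ]
    | div l => exact absurd (by simp [EVS.entry, h.exec_none]) (hd l.length)
    | inf w hw =>
      have hex : ∀ i, ∃ r, fn c ((w i).restrict n) = some r := by
        intro i
        refine Option.ne_none_iff_exists'.1 fun h' => hd i ?_
        simp [EVS.entry, (h.exec_eq_none_iff hc (w i)).2 h']
      choose r hr using hex
      refine ⟨.inf (fun i => put (w i) (r i)) (h.put_computable w r hw
        ((h.pRec c).computable (computable_restrict hw) hr)), Or.inl ⟨hd, fun i => ?_⟩⟩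
      simp [EVS.entry, h.exec_some c hc, hr]

/-! ### Matching of programs on computable sequences of memories -/

/-- The sequence `x` of inputs (with gaps) is computable and contains no input after one on which
`g` diverges; in the exact case, it is finite and `g` converges on it. -/
structure Admissible (e : Prop) (g : Mem n → Option R) (x : ℕ → Option (Mem n)) : Prop where
  computable : Computable x
  converges : ∀ {i j a}, i < j → x i = some a → x j ≠ none → g a ≠ none
  finite : e → {i | x i ≠ none}.Finite
  exact : e → ∀ {i a}, x i = some a → g a ≠ none

/-- `g'` agrees with `g` on the sequence `x` up to an input on which `g'` diverges; in the exact
case, `g'` agrees with `g` on the whole sequence. -/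
def Matches (e : Prop) (g' g : Mem n → Option R) (x : ℕ → Option (Mem n)) : Prop :=
  ∀ m a, x m = some a → (∀ i < m, ∀ b, x i = some b → g' b = g b) →
    g' a = g a ∨ ¬e ∧ g' a = none

/-- Each member of `C` is matched by members of `C'`, on all admissible sequences. -/
def Sim (fn : P → Mem n → Option R) (C C' : Set P) : Prop :=
  ∀ (e : Prop) (x : ℕ → Option (Mem n)), ∀ c ∈ C, Admissible e (fn c) x →
    ∃ c' ∈ C', Matches e (fn c') (fn c) x

/-- Let `k` be the position of `↑` in an occluding `u'`. It cannot lie before `m`, where `g'` agrees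
with the convergent `g`; `k = m` is a divergence of `g'` at `m`; and beyond `m` the outputs still
agree at `m`. -/
theorem entry_map_eq_of_below {g g' : DState → DState} {v u u' : EVS} (hu : u ∈ output g v)
    (hu' : u' ∈ output g' v) (hb : u'.Below u) {m : ℕ}
    (h : ∀ i < m, (v.entry i).map g' = (v.entry i).map g)
    (hg : ∀ i < m, (v.entry i).map g ≠ some none) :
    (v.entry m).map g' = (v.entry m).map g ∨
      (v.entry m).map g' = some none ∧ ∀ l, u ≠ .fin l := by
  have hm := output_entry hu hg
  have hm' := output_entry hu' fun i hi => by rw [h i hi]; exact hg i hi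
  rcases hb with rfl | hb
  · exact Or.inl (hm'.symm.trans hm)
  · obtain ⟨k, hk, hlt, _, hfin⟩ := hb.exists_entry
    rcases lt_trichotomy k m with hkm | rfl | hkm
    · refine absurd ?_ (hg k hkm)
      rw [← h k hkm, ← output_entry hu' fun i hi => by
        rw [h i (by omega)]; exact hg i (by omega)]
      exact hk
    · exact Or.inr ⟨hm'.symm.trans hk, hfin⟩
    · exact Or.inl (by rw [← hm, ← hm', hlt m hkm])

/-- All inputs are put into one finite vector-state. Its output contains no `↑`, so nothing occludes
it and it must be matched exactly. -/
theorem matches_of_simulates_exact (h : IsModel exec fn put (C ∪ C')) (hs : Simulates exec C C')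
    {x : ℕ → Option (Mem n)} {c : P} (hc : c ∈ C) (hfin : {i | x i ≠ none}.Finite)
    (hx : ∀ {i a}, x i = some a → fn c a ≠ none) :
    ∃ c' ∈ C', ∀ i a, x i = some a → fn c' a = fn c a := by
  obtain ⟨N, hN⟩ := hfin.bddAbove
  let l : List State := (List.range (N + 1)).filterMap fun i => (x i).map Mem.toState
  have hl : ∀ σ, σ ∈ l ↔ ∃ i a, x i = some a ∧ a.toState = σ := by
    intro σ
    simp only [l, List.mem_filterMap, List.mem_range, Option.map_eq_some_iff]
    constructor
    · rintro ⟨i, _, a, ha, rfl⟩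
      exact ⟨i, a, ha, rfl⟩
    · rintro ⟨i, a, ha, rfl⟩
      have : i ≤ N := hN (show x i ≠ none by simp [ha])
      exact ⟨i, by omega, a, ha, rfl⟩
  have hconv : ∀ i, ((EVS.fin l).entry i).map (exec c) ≠ some none := by
    intro i hi
    cases hli : l[i]? with
    | none => simp [EVS.entry, hli] at hi
    | some σ =>
      obtain ⟨j, a, hja, rfl⟩ := (hl σ).1 (List.mem_of_getElem? hli)
      simp only [EVS.entry, hli, Option.map_some, Option.some.injEq] at hi
      rw [h.exec_eq_none_iff (Or.inl hc), Mem.restrict_toState] at hi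
      exact hx hja hi
  obtain ⟨u, hu⟩ := h.output_nonempty (Or.inl hc) (.fin l)
  have hufin : ∃ m, u = .fin m := by
    have hent : ∀ i, u.entry i = ((EVS.fin l).entry i).map (exec c) :=
      fun i => output_entry hu fun j _ => hconv j
    cases u with
    | fin m => exact ⟨m, rfl⟩
    | div m => exact (hconv m.length (by rw [← hent]; simp [EVS.entry])).elim
    | inf w hw => simpa [EVS.entry] using hent l.length
  obtain ⟨m, rfl⟩ := hufin
  obtain ⟨c', hc', u', hu', hb⟩ := hs _ c hc _ hu
  have key : ∀ i, ((EVS.fin l).entry i).map (exec c') = ((EVS.fin l).entry i).map (exec c) := by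
    intro i
    induction i using Nat.strong_induction_on with
    | _ i ih =>
      rcases entry_map_eq_of_below hu hu' hb ih fun j _ => hconv j with h' | ⟨_, h'⟩
      · exact h'
      · exact (h' m rfl).elim
  refine ⟨c', hc', fun i a ha => ?_⟩
  obtain ⟨j, hj, hja⟩ := List.mem_iff_getElem.1 ((hl a.toState).2 ⟨i, a, ha, rfl⟩)
  have := key j
  simp only [EVS.entry, List.getElem?_eq_getElem hj, hja, Option.map_some, Option.some.injEq]
    at this
  rwa [h.exec_eq_iff (Or.inl hc) (Or.inr hc'), Mem.restrict_toState] at this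

/-- The sequence that repeats the last defined value of `x`, and begins with `d`. -/
def fillGaps {α : Type*} (x : ℕ → Option α) (d : α) : ℕ → α
  | 0 => (x 0).getD d
  | k + 1 => (x (k + 1)).getD (fillGaps x d k)

theorem computable_fillGaps {α : Type*} [Primcodable α] {x : ℕ → Option α} (hx : Computable x)
    (d : α) : Computable (fillGaps x d) := by
  have h := Computable.nat_rec (f := fun k : ℕ => k) (g := fun _ => (x 0).getD d)
    (h := fun _ (q : ℕ × α) => (x (q.1 + 1)).getD q.2) Computable.id (Computable.const _)
    (Computable.option_getD (hx.comp (Computable.succ.comp (Computable.fst.comp Computable.snd)))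
      (Computable.snd.comp Computable.snd)).to₂
  refine h.of_eq fun k => ?_
  induction k with
  | zero => rfl
  | succ k ih => rw [fillGaps, ← ih]

theorem fillGaps_eq {α : Type*} {x : ℕ → Option α} {d : α} {i : ℕ} {a : α} (h : x i = some a) :
    fillGaps x d i = a := by
  cases i <;> simp [fillGaps, h]

theorem fillGaps_cases {α : Type*} (x : ℕ → Option α) (d : α) (i : ℕ) :
    (∃ j ≤ i, x j = some (fillGaps x d i)) ∨ (∀ j ≤ i, x j = none) ∧ fillGaps x d i = d := by
  induction i with
  | zero => cases h : x 0 <;> simp [fillGaps, h]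
  | succ i ih =>
    cases h : x (i + 1) with
    | some a => exact Or.inl ⟨i + 1, le_rfl, by simp [fillGaps, h]⟩
    | none =>
      have : fillGaps x d (i + 1) = fillGaps x d i := by simp [fillGaps, h]
      rw [this]
      refine ih.imp (fun ⟨j, hj, h'⟩ => ⟨j, by omega, h'⟩) fun ⟨h1, h2⟩ => ⟨fun j hj => ?_, h2⟩
      rcases Nat.le_succ_iff.1 hj with h3 | rfl
      · exact h1 j h3
      · exact h

/-- Outside the exact mode, the gaps of `x` are filled with inputs that occur in `x`, which gives an
infinite vector-state that tests nothing new. The leading gaps receive the first input. -/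
theorem sim_of_simulates (h : IsModel exec fn put (C ∪ C')) (hs : Simulates exec C C') :
    Sim fn C C' := by
  intro e x c hc hx
  by_cases he : e
  · obtain ⟨c', hc', h'⟩ := matches_of_simulates_exact h hs hc (hx.finite he) (hx.exact he)
    exact ⟨c', hc', fun m a ha _ => Or.inl (h' m a ha)⟩
  by_cases hne : ∃ p, x p ≠ none
  · classical
    have hp := Nat.find_spec hne
    have hlt : ∀ i < Nat.find hne, x i = none := fun i hi => not_not.1 (Nat.find_min hne hi)
    set p := Nat.find hne
    obtain ⟨d, hd⟩ := Option.ne_none_iff_exists'.1 hp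
    have hy := computable_fillGaps hx.computable d
    set y := fillGaps x d with hydef
    let v : EVS := .inf (fun i => (y i).toState) (computableSeq_toState hy)
    obtain ⟨u, hu⟩ := h.output_nonempty (Or.inl hc) v
    obtain ⟨c', hc', u', hu', hb⟩ := hs v c hc u hu
    have key : ∀ m, (∀ i < m, fn c' (y i) = fn c (y i)) → (∀ i < m, fn c (y i) ≠ none) →
        fn c' (y m) = fn c (y m) ∨ fn c' (y m) = none := by
      intro m h1 h2
      have := entry_map_eq_of_below hu hu' hb (m := m)
        (fun i hi => by
          simp only [v, EVS.entry, Option.map_some, Option.some.injEq]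
          rw [h.exec_eq_iff (Or.inl hc) (Or.inr hc'), Mem.restrict_toState]
          exact h1 i hi)
        (fun i hi => by
          simp only [v, EVS.entry, Option.map_some, ne_eq, Option.some.injEq]
          rw [h.exec_eq_none_iff (Or.inl hc), Mem.restrict_toState]
          exact h2 i hi)
      simp only [v, EVS.entry, Option.map_some, Option.some.injEq] at this
      rw [h.exec_eq_iff (Or.inl hc) (Or.inr hc'), h.exec_eq_none_iff (Or.inr hc'),
        Mem.restrict_toState] at this
      exact this.imp_right And.left
    refine ⟨c', hc', fun m a ha hm => ?_⟩
    refine Or.imp_right (fun h' => ⟨he, h'⟩) ?_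
    have hpm : p ≤ m := by
      by_contra hmp
      rw [hlt m (by omega)] at ha
      cases ha
    rcases hpm.eq_or_lt with hpm | hpm
    -- The first input of `x` already stands at position `0` of `y`, where agreement on earlier
    -- entries is vacuous.
    · have hy0 : y 0 = a := by
        have had : d = a := by rw [← hpm, hd] at ha; exact Option.some.inj ha
        rcases fillGaps_cases x d 0 with ⟨j, hj, h'⟩ | ⟨_, h'⟩
        · have hj0 : j = 0 := by omega
          have : j = p := by
            by_contra hjp
            rw [hlt j (by omega)] at h'
            cases h'
          rw [this, hd] at h'
          rw [← had]
          exact (Option.some.inj h').symm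
        · exact h'.trans had
      rw [← hy0]
      exact key 0 (by simp) (by simp)
    · have hprev : ∀ i < m, ∃ j < m, x j = some (y i) := by
        intro i hi
        rcases fillGaps_cases x d i with ⟨j, hj, h'⟩ | ⟨_, h'⟩
        · exact ⟨j, by omega, h'⟩
        · exact ⟨p, hpm, by rw [hd, hydef, h']⟩
      have hym : y m = a := fillGaps_eq ha
      rw [← hym]
      refine key m (fun i hi => ?_) fun i hi => ?_
      · obtain ⟨j, hj, hxj⟩ := hprev i hi
        exact hm j hj _ hxj
      · obtain ⟨j, hj, hxj⟩ := hprev i hi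
        exact hx.converges hj hxj (by simp [ha])
  -- Without inputs, any member of `C'` will do; the empty vector-state shows that there is one.
  · push Not at hne
    obtain ⟨u, hu⟩ := h.output_nonempty (Or.inl hc) (.fin [])
    obtain ⟨c', hc', -⟩ := hs _ c hc u hu
    exact ⟨c', hc', fun m a ha => by rw [hne m] at ha; cases ha⟩

/-- The memories of the entries of `v` up to the first one on which `g` diverges. -/
noncomputable def queries (n : ℕ) (g : DState → DState) (v : EVS) (i : ℕ) : Option (Mem n) :=
  open Classical in
  if ∃ j < i, (v.entry j).map g = some none then none
  else (v.entry i).join.map (State.restrict n)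

theorem queries_eq_some {g : DState → DState} {v : EVS} {i : ℕ} {a : Mem n} :
    queries n g v i = some a ↔ (∀ j < i, (v.entry j).map g ≠ some none) ∧
      ∃ σ, v.entry i = some (some σ) ∧ σ.restrict n = a := by
  unfold queries
  split_ifs with h
  · simp only [false_iff, not_and]
    obtain ⟨j, hj, hd⟩ := h
    exact fun h' => (h' j hj hd).elim
  · push Not at h
    simp only [Option.map_eq_some_iff, Option.join_eq_some_iff]
    exact (and_iff_right h).symm

theorem finite_queries_of_diverges {g : DState → DState} {v : EVS} {k : ℕ}
    (h : (v.entry k).map g = some none) : {i | queries n g v i ≠ none}.Finite := by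
  refine (Set.finite_le_nat k).subset fun i hi => ?_
  obtain ⟨a, ha⟩ := Option.ne_none_iff_exists'.1 hi
  exact not_lt.1 fun hk => (queries_eq_some.1 ha).1 k hk h

theorem finite_queries_of_entry {g : DState → DState} {v : EVS} {k : ℕ}
    (h : v.entry k = none) : {i | queries n g v i ≠ none}.Finite := by
  refine (Set.finite_le_nat k).subset fun i hi => ?_
  obtain ⟨a, ha⟩ := Option.ne_none_iff_exists'.1 hi
  obtain ⟨-, σ, hσ, -⟩ := queries_eq_some.1 ha
  change i ≤ k
  refine not_lt.1 fun hk => ?_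
  rw [EVS.entry_none_of_le h hk.le] at hσ
  cases hσ

/-- The support is infinite only if `v` is infinite and `g` never diverges on it, and then the
memories are computed from `v` itself. -/
theorem computable_queries (g : DState → DState) (v : EVS) : Computable (queries n g v) := by
  by_cases hd : ∃ k, (v.entry k).map g = some none
  · obtain ⟨k, hk⟩ := hd
    exact computable_of_finite_support (finite_queries_of_diverges hk)
  · push Not at hd
    cases v with
    | fin l =>
      exact computable_of_finite_support (finite_queries_of_entry (k := l.length) (by
        simp [EVS.entry]))
    | div l =>
      exact computable_of_finite_support (finite_queries_of_entry (k := l.length + 1) (by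
        simp [EVS.entry]))
    | inf w hw =>
      refine (Computable.option_some.comp (computable_restrict hw)).of_eq fun i => ?_
      exact (queries_eq_some.2 ⟨fun j _ => hd j, w i, rfl, rfl⟩).symm

/-- Exact mode is chosen precisely when `u` is finite. If `c'` agrees with `c` up to the first
divergence of `c`, then `u` is also an output of `c'`. Otherwise, at the first disagreement `c'` can
only diverge, and its output is cut off there and occludes `u`. -/
theorem simulates_of_sim (h : IsModel exec fn put (C ∪ C')) (hs : Sim fn C C') :
    Simulates exec C C' := by
  intro v c hc u hu
  have hnone : ∀ {i a}, queries n (exec c) v i = some a → fn c a = none →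
      (v.entry i).map (exec c) = some none := by
    intro i a ha hf
    obtain ⟨-, σ, hσ, rfl⟩ := queries_eq_some.1 ha
    rw [hσ, Option.map_some, (h.exec_eq_none_iff (Or.inl hc) σ).2 hf]
  have hconv : ∀ {l}, u = .fin l → ∀ i, (v.entry i).map (exec c) ≠ some none := by
    rintro l rfl i hi
    rcases hu with ⟨h', -⟩ | ⟨k, hk, -, h', -⟩
    · exact h' i hi
    · have := h' k le_rfl
      rw [hk] at this
      cases hl : l[k]? <;> simp [EVS.entry, hl] at this
  have hadm : Admissible (∃ l, u = .fin l) (fn c) (queries n (exec c) v) :=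
    { computable := computable_queries _ _
      converges := by
        intro i j a hij hi hj hf
        obtain ⟨b, hb⟩ := Option.ne_none_iff_exists'.1 hj
        exact (queries_eq_some.1 hb).1 i hij (hnone hi hf)
      finite := by
        rintro ⟨l, rfl⟩
        have hent := output_entry hu (i := l.length) fun j _ => hconv rfl j
        refine finite_queries_of_entry (k := l.length) ?_
        simpa [EVS.entry] using hent.symm
      exact := by
        rintro ⟨l, hl⟩ i a hi hf
        exact hconv hl i (hnone hi hf) }
  obtain ⟨c', hc', hm⟩ := hs _ _ c hc hadm
  refine ⟨c', hc', ?_⟩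
  by_cases hall : ∀ m, (∀ j < m, (v.entry j).map (exec c) ≠ some none) →
      (v.entry m).map (exec c') = (v.entry m).map (exec c)
  · refine ⟨u, ?_, Or.inl rfl⟩
    rcases hu with ⟨h1, h2⟩ | ⟨k, hk, h1, h2, h3⟩
    · have := fun m => hall m fun j _ => h1 j
      rw [output_congr this]
      exact Or.inl ⟨h1, h2⟩
    · have : ∀ m ≤ k, (v.entry m).map (exec c') = (v.entry m).map (exec c) :=
        fun m hm => hall m fun j hj => h1 j (by omega)
      refine Or.inr ⟨k, ?_, fun i hi => ?_, fun i hi => ?_, h3⟩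
      · rw [this k le_rfl, hk]
      · rw [this i hi.le]; exact h1 i hi
      · rw [this i hi]; exact h2 i hi
  · obtain ⟨u', hu'⟩ := h.output_nonempty (Or.inr hc') v
    refine ⟨u', hu', Or.inr ?_⟩
    classical
    push Not at hall
    obtain ⟨hg, hne⟩ := Nat.find_spec hall
    have hmin : ∀ i < Nat.find hall, (v.entry i).map (exec c') = (v.entry i).map (exec c) := by
      intro i hi
      have := Nat.find_min hall hi
      push Not at this
      exact this fun j hj => hg j (by omega)
    set m := Nat.find hall
    have hum := output_entry hu hg
    have hum' := output_entry hu' fun i hi => by rw [hmin i hi]; exact hg i hi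
    cases hvm : v.entry m with
    | none => rw [hvm] at hne; exact (hne rfl).elim
    | some d =>
      cases d with
      | none => rw [hvm] at hne; simp [h.exec_none] at hne
      | some σ =>
        rw [hvm, Option.map_some] at hum hum'
        have hq := (queries_eq_some (n := n)).2 ⟨hg, σ, hvm, rfl⟩
        have hprev : ∀ i < m, ∀ b, queries n (exec c) v i = some b → fn c' b = fn c b := by
          intro i hi b hb
          obtain ⟨-, τ, hτ, rfl⟩ := queries_eq_some.1 hb
          have := hmin i hi
          rw [hτ, Option.map_some, Option.map_some, Option.some.injEq] at this
          exact (h.exec_eq_iff (Or.inl hc) (Or.inr hc') τ).1 this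
        rcases hm m _ hq hprev with h' | ⟨he, h'⟩
        · rw [← h.exec_eq_iff (Or.inl hc) (Or.inr hc')] at h'
          rw [hvm, Option.map_some, Option.map_some, h'] at hne
          exact (hne rfl).elim
        · rw [← h.exec_eq_none_iff (Or.inr hc')] at h'
          refine EVS.occludes_of_entry (k := m) (by rw [hum', h']) (fun i hi => ?_)
            (by simp [hum]) fun l hl => he ⟨l, hl⟩
          rw [output_entry hu fun j hj => hg j (by omega), ← hmin i hi]
          exact output_entry hu' fun j hj => by
            rw [hmin j (by omega)]; exact hg j (by omega)

theorem sim_of_setSem_eq (h : IsModel exec fn put (C ∪ C'))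
    (hs : setSem exec C = setSem exec C') : Sim fn C C' :=
  sim_of_simulates h (simulates_of_setSem_eq hs)

theorem setSem_eq_of_sim (h : IsModel exec fn put (C ∪ C')) (hs : Sim fn C C')
    (hs' : Sim fn C' C) : setSem exec C = setSem exec C' :=
  setSem_eq_of_simulates (simulates_of_sim h hs)
    (simulates_of_sim (by rwa [Set.union_comm]) hs')

end

/-! ### Matching for the constructors -/

section

variable {n : ℕ} {P P₁ P₂ R R₁ R₂ : Type}

/-- Total programs cannot diverge, so even the inexact mode forces equality, and admissibility
reduces to computability. -/
theorem Sim.exists_eq {f : P → Mem n → R} {C C' : Set P}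
    (h : Sim (fun c a => some (f c a)) C C') {x : ℕ → Option (Mem n)} (hx : Computable x)
    {c : P} (hc : c ∈ C) : ∃ c' ∈ C', ∀ i a, x i = some a → f c' a = f c a := by
  obtain ⟨c', hc', hm⟩ := h False x c hc ⟨hx, by simp, False.elim, False.elim⟩
  refine ⟨c', hc', fun i => ?_⟩
  induction i using Nat.strong_induction_on with
  | _ i ih =>
    intro a ha
    have := hm i a ha fun j hj b hb => congrArg some (ih j hj b hb)
    simpa using this

theorem Sim.map {f : P₁ → Mem n → R₁} {fn : P → Mem n → Option R} {C C' : Set P₁} {k : P₁ → P}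
    {op : Mem n → R₁ → Option R} (hk : ∀ c a, fn (k c) a = op a (f c a))
    (h : Sim (fun c a => some (f c a)) C C') : Sim fn (k '' C) (k '' C') := by
  rintro e x _ ⟨c, hc, rfl⟩ hx
  obtain ⟨c', hc', h'⟩ := h.exists_eq hx.computable hc
  refine ⟨k c', ⟨c', hc', rfl⟩, fun m a ha _ => Or.inl ?_⟩
  rw [hk, hk, h' m a ha]

theorem Sim.map₂ {f₁ : P₁ → Mem n → R₁} {f₂ : P₂ → Mem n → R₂} {fn : P → Mem n → Option R}
    {C₁ C₁' : Set P₁} {C₂ C₂' : Set P₂} {k : P₁ → P₂ → P} {op : Mem n → R₁ → R₂ → Option R}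
    (hk : ∀ c d a, fn (k c d) a = op a (f₁ c a) (f₂ d a))
    (h₁ : Sim (fun c a => some (f₁ c a)) C₁ C₁') (h₂ : Sim (fun c a => some (f₂ c a)) C₂ C₂') :
    Sim fn (Set.image2 k C₁ C₂) (Set.image2 k C₁' C₂') := by
  rintro e x _ ⟨c, hc, d, hd, rfl⟩ hx
  obtain ⟨c', hc', h₁'⟩ := h₁.exists_eq hx.computable hc
  obtain ⟨d', hd', h₂'⟩ := h₂.exists_eq hx.computable hd
  refine ⟨k c' d', ⟨c', hc', d', hd', rfl⟩, fun m a ha _ => Or.inl ?_⟩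
  rw [hk, hk, h₁' m a ha, h₂' m a ha]

theorem Sim.refl (fn : P → Mem n → Option R) (C : Set P) : Sim fn C C :=
  fun _ _ c hc _ => ⟨c, hc, fun _ _ _ _ => Or.inl rfl⟩

/-- The first statement is imitated along `x`, the second along the sequence of results of the
original first statement. -/
theorem Sim.seq {S₁ S₁' S₂ S₂' : Set Stmt} (h₁ : Sim (Stmt.fn n) S₁ S₁')
    (h₂ : Sim (Stmt.fn n) S₂ S₂') :
    Sim (Stmt.fn n) (Set.image2 Stmt.seq S₁ S₂) (Set.image2 Stmt.seq S₁' S₂') := by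
  rintro e x _ ⟨s, hs, t, ht, rfl⟩ hx
  have hfn : ∀ s t : Stmt, (Stmt.seq s t).fn n = fun a => (s.fn n a).bind (t.fn n) :=
    fun s t => by funext a; rw [Stmt.fn]
  rw [hfn] at hx
  have hne : ∀ {a}, (s.fn n a).bind (t.fn n) ≠ none → s.fn n a ≠ none := by
    intro a ha h
    simp [h] at ha
  obtain ⟨s', hs', hms⟩ := h₁ e x s hs
    ⟨hx.computable, fun hij hi hj => hne (hx.converges hij hi hj), hx.finite,
      fun he _ _ ha => hne (hx.exact he ha)⟩
  have hsub : {i | (x i).bind (s.fn n) ≠ none} ⊆ {i | x i ≠ none} := by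
    intro i hi h
    simp [h] at hi
  -- If `s` diverges on some input, that input is the last one and the sequence is finite.
  have hcomp : Computable fun i => (x i).bind (s.fn n) := by
    by_cases hall : ∀ i a, x i = some a → s.fn n a ≠ none
    · exact s.pRec_fn.computable_bind hx.computable hall
    · push Not at hall
      obtain ⟨i, a, ha, hnone⟩ := hall
      refine computable_of_finite_support (((Set.finite_le_nat i).subset fun j hj => ?_).subset
        hsub)
      change j ≤ i
      refine not_lt.1 fun hij => ?_
      exact hne (hx.converges hij ha hj) hnone
  obtain ⟨t', ht', hmt⟩ := h₂ e (fun i => (x i).bind (s.fn n)) t ht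
    { computable := hcomp
      converges := by
        intro i j b hij hi hj
        obtain ⟨a, ha, hab⟩ := Option.bind_eq_some_iff.1 hi
        have := hx.converges hij ha (hsub hj)
        rwa [hab, Option.bind_some] at this
      finite := fun he => (hx.finite he).subset hsub
      exact := by
        intro he i b hi
        obtain ⟨a, ha, hab⟩ := Option.bind_eq_some_iff.1 hi
        have := hx.exact he ha
        rwa [hab, Option.bind_some] at this }
  refine ⟨_, ⟨s', hs', t', ht', rfl⟩, ?_⟩
  rw [hfn, hfn]
  intro m a ha hprev
  have hconv : ∀ i < m, ∀ b, x i = some b → (s.fn n b).bind (t.fn n) ≠ none :=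
    fun i hi b hb => hx.converges hi hb (by simp [ha])
  -- Before `m` the imitation agrees with a convergent run of the original, which rules out a
  -- divergence of `s'`.
  have hs'eq : ∀ i < m, ∀ b, x i = some b → s'.fn n b = s.fn n b := by
    intro i
    induction i using Nat.strong_induction_on with
    | _ i ih =>
      intro hi b hb
      rcases hms i b hb fun j hj => ih j hj (by omega) with h | ⟨_, h⟩
      · exact h
      · refine absurd ?_ (hconv i hi b hb)
        exact (hprev i hi b hb).symm.trans (by simp [h])
  rcases hms m a ha hs'eq with h | ⟨he, h⟩
  · cases hsa : s.fn n a with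
    | none => exact Or.inl (by simp [h, hsa])
    | some c =>
      have := hmt m c (by simp [ha, hsa]) fun i hi d hd => by
        obtain ⟨b, hb, hbd⟩ := Option.bind_eq_some_iff.1 hd
        have := hprev i hi b hb
        simpa [hs'eq i hi b hb, hbd] using this
      simpa [h, hsa] using this
  · exact Or.inr ⟨he, by simp [h]⟩

theorem computable_filter {α γ : Type*} [Primcodable α] [Primcodable γ] {b : α → Bool}
    (hb : Computable b) {x : γ → Option α} (hx : Computable x) :
    Computable fun i => (x i).filter b := by
  refine (Computable.option_bind hx (g := fun _ a => bif b a then some a else none)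
    (Computable.cond (hb.comp Computable.snd) (Computable.option_some.comp Computable.snd)
      (Computable.const none)).to₂).of_eq fun i => ?_
  cases x i with
  | none => rfl
  | some a => cases h : b a <;> simp [Option.filter, h]

/-- Each branch is imitated along the inputs that select it; the other inputs become gaps. -/
theorem Sim.ite {B B' : Set BExp} {S₁ S₁' S₂ S₂' : Set Stmt}
    (hB : Sim (fun b (a : Mem n) => some (b.fn n a)) B B') (h₁ : Sim (Stmt.fn n) S₁ S₁')
    (h₂ : Sim (Stmt.fn n) S₂ S₂') {b : BExp} {s t : Stmt} (hb : b ∈ B) (hs : s ∈ S₁) (ht : t ∈ S₂)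
    {e : Prop} {x : ℕ → Option (Mem n)} (hx : Admissible e ((Stmt.ite b s t).fn n) x) :
    ∃ b' ∈ B', ∃ s' ∈ S₁', ∃ t' ∈ S₂',
      Matches e ((Stmt.ite b' s' t').fn n) ((Stmt.ite b s t).fn n) x := by
  have hfn : ∀ (b : BExp) (s t : Stmt), (Stmt.ite b s t).fn n =
      fun a => bif b.fn n a then s.fn n a else t.fn n a :=
    fun b s t => by funext a; rw [Stmt.fn]
  rw [hfn] at hx
  obtain ⟨b', hb', hbb⟩ := hB.exists_eq hx.computable hb
  have hadm : ∀ (s₀ : Stmt) (c : Mem n → Bool), Computable c →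
      (∀ a, c a = true → (bif b.fn n a then s.fn n a else t.fn n a) = s₀.fn n a) →
      Admissible e (s₀.fn n) fun i => (x i).filter c := by
    intro s₀ c hc hs₀
    have hsub : {i | (x i).filter c ≠ none} ⊆ {i | x i ≠ none} := by
      intro i hi h
      simp [h] at hi
    exact
      { computable := computable_filter hc hx.computable
        converges := by
          intro i j a hij hi hj
          obtain ⟨ha, hca⟩ := Option.filter_eq_some_iff.1 hi
          rw [← hs₀ a hca]
          exact hx.converges hij ha (hsub hj)
        finite := fun he => (hx.finite he).subset hsub
        exact := by
          intro he i a hi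
          obtain ⟨ha, hca⟩ := Option.filter_eq_some_iff.1 hi
          rw [← hs₀ a hca]
          exact hx.exact he ha }
  obtain ⟨s', hs', hms⟩ := h₁ e _ s hs
    (hadm s (b.fn n) b.computable_fn fun a ha => by rw [ha]; rfl)
  obtain ⟨t', ht', hmt⟩ := h₂ e _ t ht
    (hadm t (fun a => !b.fn n a) (Primrec.not.to_comp.comp b.computable_fn) fun a ha => by
      rw [Bool.not_eq_true'] at ha; rw [ha]; rfl)
  refine ⟨b', hb', s', hs', t', ht', ?_⟩
  rw [hfn, hfn]
  intro m a ha hprev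
  cases hba : b.fn n a with
  | true =>
    simp only [hbb m a ha, hba, cond_true]
    refine hms m a (Option.filter_eq_some_iff.2 ⟨ha, hba⟩) fun i hi d hd => ?_
    obtain ⟨hxd, hbd⟩ := Option.filter_eq_some_iff.1 hd
    simpa [hbb i d hxd, hbd] using hprev i hi d hxd
  | false =>
    simp only [hbb m a ha, hba, cond_false]
    refine hmt m a (Option.filter_eq_some_iff.2 ⟨ha, by simp [hba]⟩) fun i hi d hd => ?_
    obtain ⟨hxd, hbd⟩ := Option.filter_eq_some_iff.1 hd
    rw [Bool.not_eq_true'] at hbd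
    simpa [hbb i d hxd, hbd] using hprev i hi d hxd

end

/-! ### The concatenation of a sequence of sequences -/

section

variable {α : Type*}

/-- The positions in the concatenation of the sequences `k ↦ z (i, k)`; each of them is left where
it is first undefined. -/
def flatPos (z : ℕ × ℕ → Option α) : ℕ → ℕ × ℕ
  | 0 => (0, 0)
  | m + 1 =>
    bif (z (flatPos z m)).isSome then ((flatPos z m).1, (flatPos z m).2 + 1)
    else ((flatPos z m).1 + 1, 0)

variable {z : ℕ × ℕ → Option α}

theorem computable_flatPos [Primcodable α] (hz : Computable z) : Computable (flatPos z) := by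
  have h := Computable.nat_rec (f := fun k : ℕ => k) (g := fun _ => ((0, 0) : ℕ × ℕ))
    (h := fun _ (q : ℕ × ℕ × ℕ) => bif (z q.2).isSome then (q.2.1, q.2.2 + 1) else (q.2.1 + 1, 0))
    Computable.id (Computable.const _) (by
      have h2 : Computable fun p : ℕ × ℕ × ℕ × ℕ => p.2.2 := Computable.snd.comp Computable.snd
      exact (Computable.cond (Primrec.option_isSome.to_comp.comp (hz.comp h2))
        (Computable.pair (Computable.fst.comp h2)
          (Computable.succ.comp (Computable.snd.comp h2)))
        (Computable.pair (Computable.succ.comp (Computable.fst.comp h2))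
          (Computable.const 0))).to₂)
  refine h.of_eq fun k => ?_
  induction k with
  | zero => rfl
  | succ k ih => rw [flatPos, ← ih]

theorem flatPos_succ_of_ne {m i k : ℕ} (h : flatPos z m = (i, k)) (hz : z (i, k) ≠ none) :
    flatPos z (m + 1) = (i, k + 1) := by
  rw [flatPos, h, Option.isSome_iff_ne_none.2 hz]
  rfl

theorem flatPos_succ_of_eq {m i k : ℕ} (h : flatPos z m = (i, k)) (hz : z (i, k) = none) :
    flatPos z (m + 1) = (i + 1, 0) := by
  rw [flatPos, h, hz]
  rfl

theorem flatPos_lt (z : ℕ × ℕ → Option α) {l m : ℕ} (h : l < m) :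
    (flatPos z l).1 < (flatPos z m).1 ∨
      (flatPos z l).1 = (flatPos z m).1 ∧ (flatPos z l).2 < (flatPos z m).2 := by
  have hstep : ∀ m, (flatPos z m).1 < (flatPos z (m + 1)).1 ∨
      (flatPos z m).1 = (flatPos z (m + 1)).1 ∧ (flatPos z m).2 < (flatPos z (m + 1)).2 := by
    intro m
    by_cases hz : z (flatPos z m) = none
    · rw [flatPos_succ_of_eq (Prod.eta _).symm hz]
      simp
    · rw [flatPos_succ_of_ne (Prod.eta _).symm hz]
      simp
  induction m, h using Nat.le_induction with
  | base => exact hstep l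
  | succ m _ ih =>
    have := hstep m
    omega

theorem flatPos_injective (z : ℕ × ℕ → Option α) : Function.Injective (flatPos z) := by
  intro l m h
  rcases lt_trichotomy l m with hlm | hlm | hlm
  · have := flatPos_lt z hlm
    rw [h] at this
    omega
  · exact hlm
  · have := flatPos_lt z hlm
    rw [h] at this
    omega

theorem exists_flatPos_of_le {m i k l : ℕ} (h : flatPos z m = (i, k)) (hl : l ≤ k) :
    ∃ m' ≤ m, flatPos z m' = (i, l) := by
  induction m generalizing k with
  | zero =>
    have hk : 0 = k := congrArg Prod.snd h
    have hl0 : l = k := by omega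
    exact ⟨0, le_rfl, by rw [h, hl0]⟩
  | succ m ih =>
    rcases hl.eq_or_lt with rfl | hl
    · exact ⟨m + 1, le_rfl, h⟩
    · by_cases hz : z (flatPos z m) = none
      · rw [flatPos_succ_of_eq (Prod.eta _).symm hz] at h
        have := congrArg Prod.snd h
        simp only at this
        omega
      · rw [flatPos_succ_of_ne (Prod.eta _).symm hz] at h
        have h1 := congrArg Prod.fst h
        have h2 := congrArg Prod.snd h
        simp only at h1 h2
        obtain ⟨m', hm', h'⟩ := ih (k := k - 1) (by ext <;> simp <;> omega) (by omega)
        exact ⟨m', by omega, h'⟩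

theorem flatPos_add {m i k : ℕ} (h : flatPos z m = (i, 0)) (hz : ∀ l < k, z (i, l) ≠ none) :
    flatPos z (m + k) = (i, k) := by
  induction k with
  | zero => exact h
  | succ k ih => exact flatPos_succ_of_ne (ih fun l hl => hz l (by omega)) (hz k (by omega))

/-- Row `i` is entered only once all earlier rows have ended; an endless row is never left. -/
theorem exists_flatPos_eq {i : ℕ} (h : ∀ j < i, ∃ k, z (j, k) = none) :
    ∃ m, flatPos z m = (i, 0) := by
  classical
  induction i with
  | zero => exact ⟨0, rfl⟩
  | succ i ih =>
    obtain ⟨m, hm⟩ := ih fun j hj => h j (by omega)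
    have hk := h i (by omega)
    exact ⟨_, flatPos_succ_of_eq (flatPos_add hm fun l hl => Nat.find_min hk hl)
      (Nat.find_spec hk)⟩

end

/-! ### Matching for loops -/

section

variable {n : ℕ}

theorem finite_orbits {α : Type*} {b : α → Bool} {s : α → Option α} {x : ℕ → Option α}
    (hx : {i | x i ≠ none}.Finite) (h : ∀ i a, x i = some a → ∃ k, orbit b s a k = none) :
    {p : ℕ × ℕ | (x p.1).bind (fun a => orbit b s a p.2) ≠ none}.Finite := by
  have hK : ∀ i, ∃ K, ∀ a, x i = some a → orbit b s a K = none := by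
    intro i
    cases hxi : x i with
    | none => exact ⟨0, by simp⟩
    | some a =>
      obtain ⟨K, hK⟩ := h i a hxi
      exact ⟨K, by rintro _ ⟨⟩; exact hK⟩
  choose K hK using hK
  refine (hx.biUnion fun i _ => (Set.finite_lt_nat (K i)).image (Prod.mk i)).subset ?_
  rintro ⟨i, k⟩ hik
  obtain ⟨c, hc⟩ := Option.ne_none_iff_exists'.1 hik
  obtain ⟨a, ha, hac⟩ := Option.bind_eq_some_iff.1 hc
  dsimp only at ha hac
  refine Set.mem_biUnion (x := i) (by simp [ha]) ⟨k, ?_, rfl⟩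
  change k < K i
  by_contra hk
  rw [orbit_eq_none_of_le (hK i a ha) (not_lt.1 hk)] at hac
  cases hac

/-- Row `i` of `z` lists the loop-head memories of the run on `x i`. The guard is imitated along the
concatenation of the rows and the body along the entries where the guard holds. An endless row hides
nothing, since after a diverging run `x` has no further inputs. -/
theorem Sim.whileDo {B B' : Set BExp} {S S' : Set Stmt}
    (hB : Sim (fun b (a : Mem n) => some (b.fn n a)) B B') (hS : Sim (Stmt.fn n) S S') :
    Sim (Stmt.fn n) (Set.image2 Stmt.whileDo B S) (Set.image2 Stmt.whileDo B' S') := by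
  rintro e x _ ⟨b, hb, s, hs, rfl⟩ hx
  have hfn : ∀ (b : BExp) (s : Stmt), (Stmt.whileDo b s).fn n = loop (b.fn n) (s.fn n) :=
    fun b s => by funext a; rw [Stmt.fn]
  rw [hfn] at hx
  let z : ℕ × ℕ → Option (Mem n) := fun p => (x p.1).bind fun a => orbit (b.fn n) (s.fn n) a p.2
  have hz : ∀ {i k c}, z (i, k) = some c ↔
      ∃ a, x i = some a ∧ orbit (b.fn n) (s.fn n) a k = some c := Option.bind_eq_some_iff
  -- A diverging call of the body is the last entry of its row, and no later row has entries.
  have hdiv : ∀ {i k c}, z (i, k) = some c → b.fn n c = true → s.fn n c = none →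
      (∀ j, i < j → x j = none) ∧ z (i, k + 1) = none := by
    intro i k c hc hbc hsc
    obtain ⟨a, ha, hac⟩ := hz.1 hc
    refine ⟨fun j hij => ?_, ?_⟩
    · by_contra hj
      exact hx.converges hij ha hj (loop_eq_none hac hbc hsc)
    · simp [z, ha, orbit, hac, hbc, hsc]
  have hfin : e → {p | z p ≠ none}.Finite := fun he =>
    finite_orbits (hx.finite he) fun i a ha => orbit_eq_none_of_loop (hx.exact he ha)
  -- If some call of the body diverges, then `z` has finite support: earlier runs terminate, this
  -- one breaks off, and no later ones exist.
  have hzc : Computable z := by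
    by_cases hall : ∀ i a k c, x i = some a → orbit (b.fn n) (s.fn n) a k = some c →
        b.fn n c = true → s.fn n c ≠ none
    · exact computable_orbit b.computable_fn s.pRec_fn hx.computable hall
    · push Not at hall
      obtain ⟨i, a, k, c, ha, hc, hbc, hsc⟩ := hall
      obtain ⟨h1, -⟩ := hdiv (hz.2 ⟨a, ha, hc⟩) hbc hsc
      refine computable_of_finite_support (finite_orbits ?_ fun j d hd => ?_)
      · refine (Set.finite_le_nat i).subset fun j hj => ?_
        change j ≤ i
        exact not_lt.1 fun hij => hj (h1 j hij)
      · rcases lt_trichotomy j i with hji | rfl | hij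
        · exact orbit_eq_none_of_loop (hx.converges hji hd (by simp [ha]))
        · rw [ha] at hd
          cases hd
          exact ⟨k + 1, by simp [orbit, hc, hbc, hsc]⟩
        · rw [h1 j hij] at hd
          cases hd
  have hyc : Computable fun m => z (flatPos z m) := hzc.comp (computable_flatPos hzc)
  obtain ⟨b', hb', hbb⟩ := hB.exists_eq hyc hb
  have hq : ∀ {m c}, (z (flatPos z m)).filter (b.fn n) = some c ↔
      z (flatPos z m) = some c ∧ b.fn n c = true := Option.filter_eq_some_iff
  obtain ⟨s', hs', hss⟩ := hS e (fun m => (z (flatPos z m)).filter (b.fn n)) s hs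
    { computable := computable_filter b.computable_fn hyc
      converges := by
        intro l m c hlm hl hm hsc
        obtain ⟨hl, hbc⟩ := hq.1 hl
        obtain ⟨d, hd⟩ := Option.ne_none_iff_exists'.1 hm
        obtain ⟨a', ha', had⟩ := hz.1 (hq.1 hd).1
        obtain ⟨h1, h2⟩ := hdiv hl hbc hsc
        rcases flatPos_lt z hlm with hlt | ⟨heq, hlt⟩
        · rw [h1 _ hlt] at ha'
          cases ha'
        · have h3 : z (flatPos z m) = some d := (hq.1 hd).1
          obtain ⟨a, ha, hac⟩ := hz.1 hl
          rw [heq, ha'] at ha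
          cases ha
          have h4 : orbit (b.fn n) (s.fn n) a' ((flatPos z l).2 + 1) = none := by
            simpa [z, heq, ha'] using h2
          rw [orbit_eq_none_of_le h4 hlt] at had
          cases had
      finite := by
        intro he
        refine ((hfin he).preimage (flatPos_injective z).injOn).subset fun m hm => ?_
        obtain ⟨d, hd⟩ := Option.ne_none_iff_exists'.1 hm
        change z (flatPos z m) ≠ none
        simp [(hq.1 hd).1]
      exact := by
        intro he m c hm hsc
        obtain ⟨hm, hbc⟩ := hq.1 hm
        obtain ⟨a, ha, hac⟩ := hz.1 hm
        exact hx.exact he ha (loop_eq_none hac hbc hsc) }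
  refine ⟨_, ⟨b', hb', s', hs', rfl⟩, ?_⟩
  rw [hfn, hfn]
  intro m a ha hprev
  have hconv : ∀ i < m, ∀ a, x i = some a → loop (b.fn n) (s.fn n) a ≠ none :=
    fun i hi c hc => hx.converges hi hc (by simp [ha])
  by_cases hall : ∀ l, (flatPos z l).1 ≤ m → ∀ c, z (flatPos z l) = some c → b.fn n c = true →
      s'.fn n c = s.fn n c
  -- All runs before `m` terminate, so the concatenation reaches row `m`, and agreement there makes
  -- the two runs on `a` identical.
  · obtain ⟨N, hN⟩ := exists_flatPos_eq (z := z) (i := m) fun j hj => by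
      cases hxj : x j with
      | none => exact ⟨0, by simp [z, hxj]⟩
      | some c =>
        obtain ⟨k, hk⟩ := orbit_eq_none_of_loop (hconv j hj c hxj)
        exact ⟨k, by simp [z, hxj, hk]⟩
    have hreach : ∀ k c, orbit (b.fn n) (s.fn n) a k = some c → flatPos z (N + k) = (m, k) := by
      intro k c hk
      refine flatPos_add hN fun l hl h => ?_
      have : orbit (b.fn n) (s.fn n) a l = none := by simpa [z, ha] using h
      rw [orbit_eq_none_of_le this hl.le] at hk
      cases hk
    have hzk : ∀ k c, orbit (b.fn n) (s.fn n) a k = some c →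
        z (flatPos z (N + k)) = some c := by
      intro k c hk
      rw [hreach k c hk]
      exact hz.2 ⟨a, ha, hk⟩
    have hb'' : ∀ k c, orbit (b.fn n) (s.fn n) a k = some c → b'.fn n c = b.fn n c :=
      fun k c hk => hbb _ c (hzk k c hk)
    refine Or.inl (loop_congr (fun k => orbit_congr (fun l _ => hb'' l) fun l _ c hl hbc => ?_)
      hb'')
    exact hall (N + l) (by rw [hreach l c hl]) c (hzk l c hl) hbc
  · classical
    push Not at hall
    obtain ⟨hlm, c, hc, hbc, hne⟩ := Nat.find_spec hall
    have hmin : ∀ l < Nat.find hall, ∀ c, z (flatPos z l) = some c → b.fn n c = true →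
        s'.fn n c = s.fn n c := by
      intro l hl c hc hbc
      by_contra hcon
      refine Nat.find_min hall hl ⟨?_, c, hc, hbc, hcon⟩
      have := flatPos_lt z hl
      omega
    -- At the first disagreement `s'` must diverge. The imitating run gets there, because everything
    -- before it agrees, so the imitating loop diverges on that row's input. By `hprev` and `hconv`,
    -- that row can only be `m`.
    set N := Nat.find hall
    obtain ⟨he, hs'c⟩ := (hss N c (hq.2 ⟨hc, hbc⟩) fun l hl d hd =>
      hmin l hl d (hq.1 hd).1 (hq.1 hd).2).resolve_left hne
    obtain ⟨a', ha', hac⟩ := hz.1 hc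
    have hback : ∀ l < (flatPos z N).2, ∃ N' < N, flatPos z N' = ((flatPos z N).1, l) := by
      intro l hl
      obtain ⟨N', hN', h⟩ := exists_flatPos_of_le (Prod.eta (flatPos z N)).symm hl.le
      refine ⟨N', lt_of_le_of_ne hN' ?_, h⟩
      rintro rfl
      rw [h] at hl
      exact lt_irrefl _ hl
    have horb : orbit (b'.fn n) (s'.fn n) a' (flatPos z N).2 = some c := by
      rw [← hac]
      refine orbit_congr (fun l hl d hd => ?_) fun l hl d hd hbd => ?_
      · obtain ⟨N', _, h⟩ := hback l hl
        exact hbb N' d (by rw [h]; exact hz.2 ⟨a', ha', hd⟩)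
      · obtain ⟨N', hN', h⟩ := hback l hl
        exact hmin N' hN' d (by rw [h]; exact hz.2 ⟨a', ha', hd⟩) hbd
    have hnone := loop_eq_none horb ((hbb N c hc).trans hbc) hs'c
    rcases hlm.lt_or_eq with hlt | heq
    · exact absurd ((hprev _ hlt a' ha').symm.trans hnone) (hconv _ hlt a' ha')
    · rw [heq, ha] at ha'
      cases ha'
      exact Or.inr ⟨he, hnone⟩

end

/-! ### Languages -/

/-- The variables that occur in a term. -/
def Term.vars : (τ : Ty) → Term τ → Set Var
  | .var, x => {(x : Var)}
  | .exp, e => Exp.vars e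
  | .bexp, b => BExp.vars b
  | .stmt, s => Stmt.vars s

/-- The terms that a constructor builds from operands in the given sets. -/
def Con.app {w : List Ty} {τ : Ty} (α : Con w τ) (C : Args (fun σ => Set (Term σ)) w) :
    Set (Term τ) :=
  {t | ∃ a : Args Term w, (∀ i, a i ∈ C i) ∧ α.build a = t}

/-- The variables of all terms in `C` are below `n`. -/
def Bounded (n : ℕ) {τ : Ty} (C : Set (Term τ)) : Prop := ∀ t ∈ C, Term.vars τ t ⊆ {x | x < n}

/-- A strict bound for the variable that a constructor introduces. -/
def Con.bound : {w : List Ty} → {τ : Ty} → Con w τ → ℕ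
  | _, _, .name x => x + 1
  | _, _, _ => 0

theorem Con.vars_arg_subset {w : List Ty} {τ : Ty} (α : Con w τ) (a : Args Term w)
    (i : Fin w.length) : Term.vars _ (a i) ⊆ Term.vars τ (α.build a) := by
  intro x hx
  cases α with
  | name y => exact i.elim0
  | zero => exact i.elim0
  | one => exact i.elim0
  | tt => exact i.elim0
  | ff => exact i.elim0
  | var => match i, hx with | ⟨0, _⟩, hx => exact hx
  | neg => match i, hx with | ⟨0, _⟩, hx => exact hx
  | add | sub | conj | lt | eq | assign | seq | whileDo =>
    match i, hx with
    | ⟨0, _⟩, hx => exact Or.inl hx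
    | ⟨1, _⟩, hx => exact Or.inr hx
  | ite =>
    match i, hx with
    | ⟨0, _⟩, hx => exact Or.inl (Or.inl hx)
    | ⟨1, _⟩, hx => exact Or.inl (Or.inr hx)
    | ⟨2, _⟩, hx => exact Or.inr hx

/-- The second alternative is a variable introduced by the constructor itself; it survives any
exchange of operands. -/
theorem Con.mem_vars_build {w : List Ty} {τ : Ty} (α : Con w τ) (a : Args Term w) {x : Var}
    (hx : x ∈ Term.vars τ (α.build a)) :
    (∃ i, x ∈ Term.vars _ (a i)) ∨ x < α.bound ∧ ∀ a', x ∈ Term.vars τ (α.build a') := by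
  cases α with
  | name y =>
    have hxy : x = y := hx
    subst hxy
    exact Or.inr ⟨Nat.lt_succ_self _, fun _ => rfl⟩
  | zero | one | tt | ff => exact hx.elim
  | var | neg => exact Or.inl ⟨0, hx⟩
  | add | sub | conj | lt | eq | assign | seq | whileDo =>
    rcases hx with hx | hx
    · exact Or.inl ⟨0, hx⟩
    · exact Or.inl ⟨1, hx⟩
  | ite =>
    rcases hx with (hx | hx) | hx
    · exact Or.inl ⟨0, hx⟩
    · exact Or.inl ⟨1, hx⟩
    · exact Or.inl ⟨2, hx⟩

theorem Con.bounded_app {w : List Ty} {τ : Ty} (α : Con w τ) {n : ℕ} (hα : α.bound ≤ n)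
    {C : Args (fun σ => Set (Term σ)) w} (hC : ∀ i, Bounded n (C i)) : Bounded n (α.app C) := by
  rintro _ ⟨a, ha, rfl⟩ x hx
  rcases α.mem_vars_build a hx with ⟨i, hi⟩ | ⟨hi, -⟩
  · exact hC i _ (ha i) hi
  · exact lt_of_lt_of_le hi hα

theorem Grammar.lang_eq (G : Grammar) {τ : Ty} (N : G.NT τ) :
    G.lang N = ⋃ p ∈ {p | p ∈ G.rhs N}, p.con.app fun i => G.lang (p.args i) := by
  ext t
  simp only [Set.mem_iUnion]
  constructor
  · rintro ⟨_, p, hp, a, ha⟩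
    exact ⟨p, hp, a, ha, rfl⟩
  · rintro ⟨p, hp, a, ha, rfl⟩
    exact Grammar.Derives.intro N p hp a ha

theorem finite_ty : Finite Ty := by
  refine Finite.of_surjective
    (fun i : Fin 4 => match i with | 0 => Ty.var | 1 => Ty.exp | 2 => Ty.bexp | 3 => Ty.stmt) ?_
  rintro (_ | _ | _ | _)
  · exact ⟨0, rfl⟩
  · exact ⟨1, rfl⟩
  · exact ⟨2, rfl⟩
  · exact ⟨3, rfl⟩

theorem Grammar.exists_bounded (G : Grammar) :
    ∃ n, ∀ (τ : Ty) (N : G.NT τ), Bounded n (G.lang N) := by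
  have := finite_ty
  have := G.finite
  -- For each nonterminal the sum dominates the bound of each of its productions, and there are
  -- finitely many nonterminals.
  obtain ⟨n, hn⟩ := (Set.finite_range fun N : (Σ τ, G.NT τ) =>
    ((G.rhs N.2).map fun p => p.con.bound).sum).bddAbove
  refine ⟨n, fun τ N t ht => ?_⟩
  have ht : G.Derives N t := ht
  induction ht with
  | intro N p hp a ha ih =>
    intro x hx
    rcases p.con.mem_vars_build a hx with ⟨i, hi⟩ | ⟨hi, -⟩
    · exact ih i (ha i) hi
    · refine lt_of_lt_of_le hi (le_trans ?_ (hn ⟨⟨_, N⟩, rfl⟩))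
      exact List.single_le_sum (by simp) _ (List.mem_map.2 ⟨p, hp, rfl⟩)

/-! ### Compositionality -/

/-- Every program maps the empty vector-state to itself, and that output cannot be occluded. -/
theorem nonempty_of_setSem_eq {P : Type} {exec : P → DState → DState} {C C' : Set P}
    (h : setSem exec C = setSem exec C') (hC : C.Nonempty) : C'.Nonempty := by
  obtain ⟨c, hc⟩ := hC
  obtain ⟨c', hc', -⟩ := simulates_of_setSem_eq h (.fin []) c hc (.fin [])
    (Or.inl ⟨by simp [EVS.entry], by simp [EVS.entry]⟩)
  exact ⟨c', hc'⟩

theorem nonempty_of_vectorSem_eq {τ : Ty} {C C' : Set (Term τ)}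
    (h : vectorSem τ C = vectorSem τ C') (hC : C.Nonempty) : C'.Nonempty := by
  cases τ with
  | var =>
    have h : C = C' := h
    exact h ▸ hC
  | exp => exact nonempty_of_setSem_eq (congrArg Prod.fst h) hC
  | bexp => exact nonempty_of_setSem_eq (congrArg Prod.fst h) hC
  | stmt => exact nonempty_of_setSem_eq (congrArg Prod.fst h) hC

theorem vars_eq_of_vectorSem_eq {τ : Ty} {C C' : Set (Term τ)}
    (h : vectorSem τ C = vectorSem τ C') :
    (⋃ t ∈ C, Term.vars τ t) = ⋃ t ∈ C', Term.vars τ t := by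
  cases τ with
  | var =>
    have h : C = C' := h
    rw [h]
  | exp => exact congrArg Prod.snd h
  | bexp => exact congrArg Prod.snd h
  | stmt => exact congrArg Prod.snd h

/-- A variable of one operand occurs in a built term only if the other operand sets are nonempty;
this too is determined by the denotations. -/
theorem Con.vars_app_subset {w : List Ty} {τ : Ty} (α : Con w τ)
    {C C' : Args (fun σ => Set (Term σ)) w}
    (h : ∀ i, vectorSem _ (C i) = vectorSem _ (C' i)) :
    (⋃ t ∈ α.app C, Term.vars τ t) ⊆ ⋃ t ∈ α.app C', Term.vars τ t := by
  classical
  intro x hx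
  obtain ⟨_, ⟨a, ha, rfl⟩, hx⟩ := Set.mem_iUnion₂.1 hx
  have hne : ∀ i, ∃ t, t ∈ C' i := fun i => nonempty_of_vectorSem_eq (h i) ⟨_, ha i⟩
  choose a' ha' using hne
  rcases α.mem_vars_build a hx with ⟨i, hi⟩ | ⟨-, hx⟩
  · have : x ∈ ⋃ t ∈ C i, Term.vars _ t := Set.mem_iUnion₂.2 ⟨_, ha i, hi⟩
    rw [vars_eq_of_vectorSem_eq (h i)] at this
    obtain ⟨t, ht, hxt⟩ := Set.mem_iUnion₂.1 this
    refine Set.mem_iUnion₂.2 ⟨_, ⟨Function.update a' i t, fun j => ?_, rfl⟩,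
      α.vars_arg_subset _ i (by simpa using hxt)⟩
    by_cases hj : j = i
    · subst hj
      simpa using ht
    · simpa [hj] using ha' j
  · exact Set.mem_iUnion₂.2 ⟨_, ⟨a', ha', rfl⟩, hx a'⟩

/-- The terms in `C` are matched by those in `C'`; sets of variables are compared by equality. -/
def TySim (n : ℕ) : (τ : Ty) → Set (Term τ) → Set (Term τ) → Prop
  | .var => fun X X' => X = X'
  | .exp => Sim fun (e : Exp) (m : Mem n) => some (e.fn n m)
  | .bexp => Sim fun (b : BExp) (m : Mem n) => some (b.fn n m)
  | .stmt => Sim (Stmt.fn n)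

theorem TySim.refl (n : ℕ) (τ : Ty) (C : Set (Term τ)) : TySim n τ C C := by
  cases τ with
  | var => exact Eq.refl C
  | exp => exact Sim.refl _ _
  | bexp => exact Sim.refl _ _
  | stmt => exact Sim.refl _ _

theorem Bounded.union {n : ℕ} {τ : Ty} {C C' : Set (Term τ)} (hC : Bounded n C)
    (hC' : Bounded n C') : Bounded n (C ∪ C') := by
  rintro t (ht | ht)
  · exact hC t ht
  · exact hC' t ht

theorem tySim_of_vectorSem_eq {n : ℕ} {τ : Ty} {C C' : Set (Term τ)} (hC : Bounded n C)
    (hC' : Bounded n C') (h : vectorSem τ C = vectorSem τ C') : TySim n τ C C' := by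
  cases τ with
  | var => exact h
  | exp => exact sim_of_setSem_eq (Exp.isModel (hC.union hC')) (congrArg Prod.fst h)
  | bexp => exact sim_of_setSem_eq (BExp.isModel (hC.union hC')) (congrArg Prod.fst h)
  | stmt => exact sim_of_setSem_eq (Stmt.isModel (hC.union hC')) (congrArg Prod.fst h)

theorem vectorSem_eq_of_tySim {n : ℕ} {τ : Ty} {C C' : Set (Term τ)} (hC : Bounded n C)
    (hC' : Bounded n C') (h : TySim n τ C C') (h' : TySim n τ C' C)
    (hv : (⋃ t ∈ C, Term.vars τ t) = ⋃ t ∈ C', Term.vars τ t) :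
    vectorSem τ C = vectorSem τ C' := by
  cases τ with
  | var => exact h
  | exp => exact Prod.ext (setSem_eq_of_sim (Exp.isModel (hC.union hC')) h h') hv
  | bexp => exact Prod.ext (setSem_eq_of_sim (BExp.isModel (hC.union hC')) h h') hv
  | stmt => exact Prod.ext (setSem_eq_of_sim (Stmt.isModel (hC.union hC')) h h') hv

/-- The tuple with one entry. -/
def Args.single {F : Ty → Type} {σ : Ty} (c : F σ) : Args F [σ]
  | ⟨0, _⟩ => c

/-- The tuple with two entries. -/
def Args.pair {F : Ty → Type} {σ τ : Ty} (c : F σ) (d : F τ) : Args F [σ, τ]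
  | ⟨0, _⟩ => c
  | ⟨1, _⟩ => d

/-- The tuple with three entries. -/
def Args.triple {F : Ty → Type} {ρ σ τ : Ty} (b : F ρ) (c : F σ) (d : F τ) : Args F [ρ, σ, τ]
  | ⟨0, _⟩ => b
  | ⟨1, _⟩ => c
  | ⟨2, _⟩ => d

theorem Con.app_single {σ τ : Ty} (α : Con [σ] τ) (C : Args (fun σ => Set (Term σ)) [σ]) :
    α.app C = (fun c : Term σ => α.build (Args.single c)) '' C 0 := by
  ext t
  constructor
  · rintro ⟨a, ha, rfl⟩
    refine ⟨a 0, ha 0, congrArg α.build (funext ?_)⟩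
    rintro ⟨_ | _, h⟩
    · rfl
    · simp at h
  · rintro ⟨c, hc, rfl⟩
    refine ⟨_, ?_, rfl⟩
    rintro ⟨_ | _, h⟩
    · exact hc
    · simp at h

theorem Con.app_pair {ρ σ τ : Ty} (α : Con [ρ, σ] τ) (C : Args (fun σ => Set (Term σ)) [ρ, σ]) :
    α.app C = Set.image2 (fun (c : Term ρ) (d : Term σ) => α.build (Args.pair c d))
      (C 0) (C 1) := by
  ext t
  constructor
  · rintro ⟨a, ha, rfl⟩
    refine ⟨a 0, ha 0, a 1, ha 1, congrArg α.build (funext ?_)⟩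
    rintro ⟨_ | _ | _, h⟩
    · rfl
    · rfl
    · simp at h
  · rintro ⟨c, hc, d, hd, rfl⟩
    refine ⟨_, ?_, rfl⟩
    rintro ⟨_ | _ | _, h⟩
    · exact hc
    · exact hd
    · simp at h

theorem Con.triple_mem_app {ρ σ τ υ : Ty} (α : Con [ρ, σ, τ] υ)
    {C : Args (fun σ => Set (Term σ)) [ρ, σ, τ]} {b : Term ρ} {c : Term σ} {d : Term τ}
    (hb : b ∈ C 0) (hc : c ∈ C 1) (hd : d ∈ C 2) : α.build (Args.triple b c d) ∈ α.app C := by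
  refine ⟨_, ?_, rfl⟩
  rintro ⟨_ | _ | _ | _, h⟩
  · exact hb
  · exact hc
  · exact hd
  · simp at h; omega

theorem Con.tySim_app {n : ℕ} {w : List Ty} {τ : Ty} (α : Con w τ)
    {C C' : Args (fun σ => Set (Term σ)) w} (h : ∀ i, TySim n _ (C i) (C' i)) :
    TySim n τ (α.app C) (α.app C') := by
  cases α with
  | name | zero | one | tt | ff =>
    have : C = C' := funext fun i => i.elim0
    rw [this]
    exact TySim.refl _ _ _
  | var =>
    have h0 : C 0 = C' 0 := h 0
    rw [Con.app_single, Con.app_single, h0]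
    exact TySim.refl _ _ _
  | neg =>
    rw [Con.app_single, Con.app_single]
    exact Sim.map (k := BExp.neg) (op := fun _ z => some !z) (fun _ _ => rfl) (h 0)
  | add =>
    rw [Con.app_pair, Con.app_pair]
    exact Sim.map₂ (k := Exp.add) (op := fun _ y z => some (y + z)) (fun _ _ _ => rfl) (h 0) (h 1)
  | sub =>
    rw [Con.app_pair, Con.app_pair]
    exact Sim.map₂ (k := Exp.sub) (op := fun _ y z => some (y - z)) (fun _ _ _ => rfl) (h 0) (h 1)
  | conj =>
    rw [Con.app_pair, Con.app_pair]
    exact Sim.map₂ (k := BExp.conj) (op := fun _ y z => some (y && z)) (fun _ _ _ => rfl)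
      (h 0) (h 1)
  | lt =>
    rw [Con.app_pair, Con.app_pair]
    exact Sim.map₂ (k := BExp.lt) (op := fun _ y z => some (decide (y < z))) (fun _ _ _ => rfl)
      (h 0) (h 1)
  | eq =>
    rw [Con.app_pair, Con.app_pair]
    exact Sim.map₂ (k := BExp.eq) (op := fun _ y z => some (decide (y = z))) (fun _ _ _ => rfl)
      (h 0) (h 1)
  | assign =>
    have h0 : C 0 = C' 0 := h 0
    rw [Con.app_pair, Con.app_pair, h0]
    rintro e x _ ⟨(y : Var), hy, d, hd, rfl⟩ hx
    obtain ⟨_, ⟨d', hd', rfl⟩, hm⟩ := Sim.map (fn := Stmt.fn n) (k := Stmt.assign y)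
      (op := fun m z => some fun i => bif decide (i.val = y) then z else m i)
      (fun c a => by rw [Stmt.fn]) (h 1) e x _ ⟨d, hd, rfl⟩ hx
    exact ⟨_, ⟨y, hy, d', hd', rfl⟩, hm⟩
  | seq =>
    rw [Con.app_pair, Con.app_pair]
    exact Sim.seq (h 0) (h 1)
  | ite =>
    rintro e x _ ⟨a, ha, rfl⟩ hx
    obtain ⟨b', hb', s', hs', t', ht', hm⟩ := Sim.ite (h 0) (h 1) (h 2) (ha 0) (ha 1) (ha 2) hx
    exact ⟨_, Con.ite.triple_mem_app hb' hs' ht', hm⟩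
  | whileDo =>
    rw [Con.app_pair, Con.app_pair]
    exact Sim.whileDo (h 0) (h 1)

theorem Bounded.mono {m n : ℕ} (hmn : m ≤ n) {τ : Ty} {C : Set (Term τ)} (hC : Bounded m C) :
    Bounded n C :=
  fun t ht _ hx => lt_of_lt_of_le (hC t ht hx) hmn

/-- The two families may have different bounds. A common one, which also covers a variable
introduced by `α`, makes all programs act on the same `Mem k`. -/
theorem vectorSem_app_congr {w : List Ty} {τ : Ty} (α : Con w τ) {m n : ℕ}
    {C C' : Args (fun σ => Set (Term σ)) w} (hC : ∀ i, Bounded m (C i))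
    (hC' : ∀ i, Bounded n (C' i)) (h : ∀ i, vectorSem _ (C i) = vectorSem _ (C' i)) :
    vectorSem τ (α.app C) = vectorSem τ (α.app C') := by
  let k := max α.bound (max m n)
  have hk : ∀ i, Bounded k (C i) := fun i => (hC i).mono (by simp [k])
  have hk' : ∀ i, Bounded k (C' i) := fun i => (hC' i).mono (by simp [k])
  have hα : α.bound ≤ k := le_max_left _ _
  exact vectorSem_eq_of_tySim (α.bounded_app hα hk) (α.bounded_app hα hk')
    (α.tySim_app fun i => tySim_of_vectorSem_eq (hk i) (hk' i) (h i))
    (α.tySim_app fun i => tySim_of_vectorSem_eq (hk' i) (hk i) (h i).symm)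
    ((α.vars_app_subset h).antisymm (α.vars_app_subset fun i => (h i).symm))

open Classical in
/-- The action of a constructor on denotations of sets of terms with finitely many variables. -/
noncomputable def Con.den {w : List Ty} {τ : Ty} (α : Con w τ) (d : Args Den w) : Den τ :=
  if h : ∃ C : Args (fun σ => Set (Term σ)) w,
      (∃ n, ∀ i, Bounded n (C i)) ∧ ∀ i, vectorSem _ (C i) = d i then
    vectorSem τ (α.app h.choose)
  else vectorSem τ ∅

/-- The chosen representatives may differ from `C`, but the congruence makes the choice immaterial.
-/
theorem Con.den_vectorSem {w : List Ty} {τ : Ty} (α : Con w τ) {n : ℕ}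
    {C : Args (fun σ => Set (Term σ)) w} (hC : ∀ i, Bounded n (C i)) :
    α.den (fun i => vectorSem _ (C i)) = vectorSem τ (α.app C) := by
  have h : ∃ C' : Args (fun σ => Set (Term σ)) w,
      (∃ n, ∀ i, Bounded n (C' i)) ∧ ∀ i, vectorSem _ (C' i) = vectorSem _ (C i) :=
    ⟨C, ⟨n, hC⟩, fun _ => rfl⟩
  rw [Con.den, dif_pos h]
  obtain ⟨⟨m, hm⟩, heq⟩ := h.choose_spec
  exact vectorSem_app_congr α hm hC heq

/-- The aggregation of denotations. -/
def Den.agg : {τ : Ty} → List (Den τ) → Den τ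
  | .var, l => ⋃ d ∈ {d | d ∈ l}, (d : Set Var)
  | .exp, l => (fun V => reduce (⋃ d ∈ {d | d ∈ l}, d.1 V), ⋃ d ∈ {d | d ∈ l}, d.2)
  | .bexp, l => (fun V => reduce (⋃ d ∈ {d | d ∈ l}, d.1 V), ⋃ d ∈ {d | d ∈ l}, d.2)
  | .stmt, l => (fun V => reduce (⋃ d ∈ {d | d ∈ l}, d.1 V), ⋃ d ∈ {d | d ∈ l}, d.2)

theorem biUnion_mem_map {ι δ β : Type*} (l : List ι) (g : ι → δ) (f : δ → Set β) :
    (⋃ d ∈ {d | d ∈ l.map g}, f d) = ⋃ i ∈ {i | i ∈ l}, f (g i) := by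
  ext x
  simp

theorem biUnion_biUnion {ι δ β : Type*} (S : Set ι) (C : ι → Set δ) (f : δ → Set β) :
    (⋃ c ∈ ⋃ i ∈ S, C i, f c) = ⋃ i ∈ S, ⋃ c ∈ C i, f c := by
  ext x
  simp only [Set.mem_iUnion]
  constructor
  · rintro ⟨c, ⟨i, hi, hc⟩, h⟩
    exact ⟨i, hi, c, hc, h⟩
  · rintro ⟨i, hi, c, hc, h⟩
    exact ⟨c, ⟨i, hi, hc⟩, h⟩

theorem Den.agg_map {ι : Type} {τ : Ty} (l : List ι) (C : ι → Set (Term τ)) :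
    Den.agg (l.map fun i => vectorSem τ (C i)) = vectorSem τ (⋃ i ∈ {i | i ∈ l}, C i) := by
  cases τ with
  | var => exact biUnion_mem_map l C fun d => d
  | exp =>
    refine Prod.ext (funext fun V => ?_) ?_
    · refine (congrArg reduce (biUnion_mem_map l _ _)).trans ?_
      exact (setSem_iUnion Exp.exec _ C V).symm
    · exact (biUnion_mem_map l _ _).trans (biUnion_biUnion _ C _).symm
  | bexp =>
    refine Prod.ext (funext fun V => ?_) ?_
    · refine (congrArg reduce (biUnion_mem_map l _ _)).trans ?_
      exact (setSem_iUnion BExp.exec _ C V).symm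
    · exact (biUnion_mem_map l _ _).trans (biUnion_biUnion _ C _).symm
  | stmt =>
    refine Prod.ext (funext fun V => ?_) ?_
    · refine (congrArg reduce (biUnion_mem_map l _ _)).trans ?_
      exact (setSem_iUnion Stmt.exec _ C V).symm
    · exact (biUnion_mem_map l _ _).trans (biUnion_biUnion _ C _).symm

end GImp

/-- The divergence-aware vector-state semantics of sets of programs is compositional. -/
theorem mainTheorem6 : GImp.IsCompositional GImp.vectorSem := by
  refine ⟨GImp.Con.den, GImp.Den.agg, fun G τ N => ?_⟩
  obtain ⟨n, hn⟩ := G.exists_bounded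
  have h : ∀ p : GImp.Production G.NT τ,
      (p.con.den fun i => GImp.vectorSem (p.dom.get i) (G.lang (p.args i))) =
        GImp.vectorSem τ (p.con.app fun i => G.lang (p.args i)) :=
    fun p => p.con.den_vectorSem fun i => hn _ (p.args i)
  simp only [h]
  rw [GImp.Den.agg_map, ← G.lang_eq]
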